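/- Let $m,n\ge 3$ be integers. For a full-dimensional convex polytope $P$ in a real vector space, with a point $v_F$ chosen for each facet $F$ of $P$ that lies beyond $F$ (it strictly violates the facet inequality of $F$ and strictly satisfies those of all other facets), call $Q=\operatorname{conv}\bigl(P\cup\{v_F : F \text{ a facet of } P\}\bigr)$ a vertex-preserving realisation of $E(P)$ if the facets of $Q$ are exactly the sets $\operatorname{conv}(R\cup\{v_F\})\cup\operatorname{conv}(R\cup\{v_{F'}\})$, where $R$ runs over the ridges (faces of codimension $2$) of $P$ and $F,F'$ are the two facets of $P$ containing $R$. (So the boundary of $Q$ arises from that of $P$ by stellarly subdividing all facets and merging the pieces that share a ridge of $P$.) A realisation of $E_{mn}$ from regular polygons is a vertex-preserving realisation $Q\subset\mathbb R^2\times\mathbb R^2$ of $E(P_0\times P_1)$, where $P_0,P_1\subset\mathbb R^2$ are a regular $m$-gon and a regular $n$-gon, such that, with $\pi_0,\pi_1$ the projections of $\mathbb R^2\times\mathbb R^2$ onto its two factors, (1) $\pi_0(Q)$ is a regular $m$-gon and $\pi_1(Q)$ is a regular $n$-gon; (2) all intersection ratios are equal in each factor: the fraction of the segment from $\pi_0(v_{F_0\times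 P_1})$ to $\pi_0(v_{P_0\times F_1})$ that lies outside $P_0$ is the same for all edges $F_0$ of $P_0$ and $F_1$ of $P_1$, and likewise the fraction of the segment from $\pi_1(v_{P_0\times F_1})$ to $\pi_1(v_{F_0\times P_1})$ that lies outside $P_1$ is the same for all such $F_0,F_1$. Then a realisation of $E_{mn}$ from regular polygons exists if and only if, up to interchanging $m$ and $n$, $$(m,n)\in\{(3,3),(3,4),(3,5),(3,6),(4,4)\}.$$ -/

import Mathlib

/-! Polytopes are convex hulls of finite sets of points; faces are cut out by valid inequalities. -/

namespace EConstruction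

/-- The inequality `l y ≤ a` is valid on `P`, and the face of `P` that it cuts out is `F`. -/
def CutsOut {E : Type*} [AddCommGroup E] [Module ℝ E]
    (P F : Set E) (l : E →ₗ[ℝ] ℝ) (a : ℝ) : Prop :=
  (∀ y ∈ P, l y ≤ a) ∧ F = {y | y ∈ P ∧ l y = a}

/-- `F` is a face of `P`. -/
def IsFace {E : Type*} [AddCommGroup E] [Module ℝ E] (P F : Set E) : Prop :=
  ∃ (l : E →ₗ[ℝ] ℝ) (a : ℝ), CutsOut P F l a

/-- The dimension of the affine hull of a nonempty set. -/
noncomputable def dim {E : Type*} [AddCommGroup E] [Module ℝ E] (P : Set E) : ℕ :=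
  Module.finrank ℝ (vectorSpan ℝ P)

/-- Facets are the faces of codimension one. -/
def IsFacet {E : Type*} [AddCommGroup E] [Module ℝ E] (P F : Set E) : Prop :=
  F.Nonempty ∧ IsFace P F ∧ dim F + 1 = dim P

/-- Ridges are the faces of codimension two. -/
def IsRidge {E : Type*} [AddCommGroup E] [Module ℝ E] (P R : Set E) : Prop :=
  R.Nonempty ∧ IsFace P R ∧ dim R + 2 = dim P

/-- The point `x` violates the inequality of the facet `F` of the full-dimensional polytope `P`,
and satisfies strictly the inequalities of all other facets: `x` lies beyond `F`. -/
def IsBeyond {E : Type*} [AddCommGroup E] [Module ℝ E] (P F : Set E) (x : E) : Prop :=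
  (∃ (l : E →ₗ[ℝ] ℝ) (a : ℝ), CutsOut P F l a ∧ a < l x) ∧
  ∀ G : Set E, IsFacet P G → G ≠ F → ∃ (l : E →ₗ[ℝ] ℝ) (a : ℝ), CutsOut P G l a ∧ l x < a

/-- Stellar subdivision of the facets of `P`, with the new vertex `v F` for the facet `F`, replaces
`F` by the pyramids with apex `v F` over the ridges contained in `F`. This is the union of those
pyramids whose base is the ridge `R`; there are two, one for each facet containing `R`. -/
def mergedFacet {E : Type*} [AddCommGroup E] [Module ℝ E]
    (P : Set E) (v : Set E → E) (R : Set E) : Set E :=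
  ⋃ F ∈ {F : Set E | IsFacet P F ∧ R ⊆ F}, convexHull ℝ (insert (v F) R)

/-- `Q` is a vertex-preserving polytopal realisation of `E(P)`: it is the convex hull of `P` and of
new vertices `v F`, one beyond each facet `F` of `P`, and its boundary is the result of the
`E`-construction. That is, the facets of `Q` are exactly the bipyramids obtained by merging, for
each ridge `R` of `P`, the pyramids over `R` in the stellar subdivision. The values of `v` at sets
that are not facets of `P` play no role. -/
def IsVertexPreservingE {E : Type*} [AddCommGroup E] [Module ℝ E]
    (P : Set E) (v : Set E → E) (Q : Set E) : Prop :=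
  (∀ F : Set E, IsFacet P F → IsBeyond P F (v F)) ∧
  Q = convexHull ℝ (P ∪ v '' {F : Set E | IsFacet P F}) ∧
  ∀ G : Set E, IsFacet Q G ↔ ∃ R : Set E, IsRidge P R ∧ G = mergedFacet P v R

/-- `P` is a regular convex `k`-gon (for `3 ≤ k`), with centre `c` and circumradius `ρ`. -/
def IsRegularPolygon (k : ℕ) (P : Set (EuclideanSpace ℝ (Fin 2))) : Prop :=
  ∃ (c : EuclideanSpace ℝ (Fin 2)) (ρ θ : ℝ), 0 < ρ ∧
    P = convexHull ℝ (Set.range fun j : Fin k =>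
      c + ρ • !₂[Real.cos (θ + 2 * Real.pi * j / k), Real.sin (θ + 2 * Real.pi * j / k)])

/-- For `x` outside `P` and `y` in the interior of `P`: the segment from `x` to `y` meets the
boundary of the convex set `P` in a (unique) point `q`, and the part from `x` to `q`, which is the
part outside `P`, makes up the fraction `r` of its length. -/
def HasOutsideFraction (P : Set (EuclideanSpace ℝ (Fin 2)))
    (x y : EuclideanSpace ℝ (Fin 2)) (r : ℝ) : Prop :=
  ∃ q ∈ segment ℝ x y, q ∈ frontier P ∧ dist x q = r * dist x y

/-- `Q` in `ℝ² × ℝ²` is a realisation of the `E`-construction on the product of an `m`-gon and an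
`n`-gon from regular polygons: it is a vertex-preserving realisation of `E(P₀ × P₁)`, the polygons
`P₀`, `P₁` and the projections of `Q` to the two factors (which are the `E`-constructions of `P₀`
and `P₁`) are regular, and all intersection ratios are equal in each factor. The intersection
ratios in `P₀` are taken along the segments from the projection of a vertex beyond `F₀ × P₁` to the
projection of a vertex beyond `P₀ × F₁`, and symmetrically for those in `P₁`. -/
def IsRegularRealisation (m n : ℕ)
    (Q : Set (EuclideanSpace ℝ (Fin 2) × EuclideanSpace ℝ (Fin 2))) : Prop :=
  ∃ (P₀ P₁ : Set (EuclideanSpace ℝ (Fin 2)))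
    (v : Set (EuclideanSpace ℝ (Fin 2) × EuclideanSpace ℝ (Fin 2)) →
      EuclideanSpace ℝ (Fin 2) × EuclideanSpace ℝ (Fin 2)),
    IsVertexPreservingE (P₀ ×ˢ P₁) v Q ∧
    IsRegularPolygon m P₀ ∧ IsRegularPolygon n P₁ ∧
    IsRegularPolygon m (Prod.fst '' Q) ∧ IsRegularPolygon n (Prod.snd '' Q) ∧
    (∃ r₀ : ℝ, ∀ F₀ F₁ : Set (EuclideanSpace ℝ (Fin 2)), IsFacet P₀ F₀ → IsFacet P₁ F₁ →
      HasOutsideFraction P₀ (v (F₀ ×ˢ P₁)).1 (v (P₀ ×ˢ F₁)).1 r₀) ∧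
    (∃ r₁ : ℝ, ∀ F₀ F₁ : Set (EuclideanSpace ℝ (Fin 2)), IsFacet P₀ F₀ → IsFacet P₁ F₁ →
      HasOutsideFraction P₁ (v (P₀ ×ˢ F₁)).2 (v (F₀ ×ˢ P₁)).2 r₁)

end EConstruction

/-! Put κ = cos(π/m) and κ' = cos(π/n). A realisation exists exactly when κ² + κ'² ≤ 1. This says
cos(π/n) ≤ sin(π/m), that is 1/m + 1/n ≥ 1/2, or (m-2)(n-2) ≤ 4, which leaves the listed pairs.

Necessity. Let r₀, r₁ be the two intersection ratios. The new vertices over F₀ × P₁ and P₀ × F₁ lie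
in a common facet of Q, coming from the ridge F₀ × F₁, so the segment joining them misses the
interior of P₀ × P₁. Its first coordinate is interior to P₀ after parameter r₀ and its second is
interior to P₁ before parameter 1 - r₁; hence r₀ + r₁ ≥ 1. In each factor `cos_sq_le_of_ratio` gives
κ² ≤ 1 - r₀ and κ'² ≤ 1 - r₁, and adding the three inequalities finishes. For that bound, the ridge
{w} × P₁ over a vertex w of P₀ spans a supporting hyperplane of Q that is vertical over the first
factor, so w lies on an edge of the regular m-gon π₀(Q), and different w use different edges. If R
is the circumradius of π₀(Q) and ρ that of P₀, averaging over the edge normals gives Rκ ≤ ρ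
(`inradius_le_circumradius`), while averaging the ratio equations over the edges of P₀ gives ρκ ≤ (1
- r₀)R. All centres drop out because the normals of a regular polygon sum to zero.

Sufficiency. Circumscribe about the unit m-gon the regular m-gon whose edges pass through its
vertices, twisted by an angle φ with |φ| < π/m, and likewise with ψ for the n-gon. Use the
circumscribed vertices, with zero in the other factor, as the new vertices. The ratios are 1 -
κ²/cos²φ and 1 - κ'²/cos²ψ. When they add up to one, all facets of the E-construction are given by
explicit inequalities (`isRegularRealisation_hpoly`, through the criterion
`isVertexPreservingE_hpoly`). With ψ = 0 this asks for cos φ = κ / sin(π/n), which is at most 1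
exactly under κ² + κ'² ≤ 1. -/

namespace EConstruction

open Filter Topology

/-! ### Faces, facets and ridges of polyhedra given by finitely many inequalities. -/

section Polyhedra

variable {E : Type*} [AddCommGroup E] [Module ℝ E] {K : Type*}

/-- The polyhedron of the inequalities `f k x ≤ b k`. -/
def hpoly (f : K → E →ₗ[ℝ] ℝ) (b : K → ℝ) : Set E := {x | ∀ k, f k x ≤ b k}

/-- The points of the polyhedron at which the inequalities in `S` are tight. -/
def hface (f : K → E →ₗ[ℝ] ℝ) (b : K → ℝ) (S : Set K) : Set E :=
  {x | x ∈ hpoly f b ∧ ∀ k ∈ S, f k x = b k}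

/-- The inequalities that are tight at `z`. -/
def tight (f : K → E →ₗ[ℝ] ℝ) (b : K → ℝ) (z : E) : Set K := {k | f k z = b k}

variable {f : K → E →ₗ[ℝ] ℝ} {b : K → ℝ}

lemma convex_hpoly : Convex ℝ (hpoly f b) := by
  have : hpoly f b = ⋂ k, {x | f k x ≤ b k} := by ext; simp [hpoly]
  rw [this]
  exact convex_iInter fun k => convex_halfSpace_le (f k).isLinear _

lemma hface_empty : hface f b ∅ = hpoly f b := by
  ext; simp [hface]

/-- Inequalities slack at `z` survive a short step by continuity, and those tight at `z` survive by
the assumption on `d`; finiteness of `K` gives a common step length. -/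
lemma exists_pos_step [Finite K] {z d : E} (hz : z ∈ hpoly f b)
    (hd : ∀ k, f k z = b k → f k d ≤ 0) : ∃ ε : ℝ, 0 < ε ∧ z + ε • d ∈ hpoly f b := by
  have key : ∀ k, ∀ᶠ ε : ℝ in 𝓝[>] 0, f k (z + ε • d) ≤ b k := by
    intro k
    rcases eq_or_lt_of_le (hz k) with h | h
    · filter_upwards [self_mem_nhdsWithin] with ε hε
      have : (0 : ℝ) < ε := hε
      simp only [map_add, map_smul, smul_eq_mul]
      nlinarith [hd k h]
    · have hc : Continuous fun ε : ℝ => f k (z + ε • d) := by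
        simp only [map_add, map_smul, smul_eq_mul]; fun_prop
      have h0 : f k (z + (0 : ℝ) • d) < b k := by simpa using h
      have := hc.continuousAt.eventually_lt (continuousAt_const (x := (0 : ℝ)) (y := b k)) h0
      filter_upwards [nhdsWithin_le_nhds this] with ε hε using hε.le
  have h2 := (eventually_all.2 key).and self_mem_nhdsWithin
  obtain ⟨ε, h1, h3⟩ := h2.exists
  exact ⟨ε, h3, h1⟩

lemma le_zero_of_max [Finite K] {l : E →ₗ[ℝ] ℝ} {a : ℝ} (hl : ∀ y ∈ hpoly f b, l y ≤ a) {z d : E}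
    (hz : z ∈ hpoly f b) (ha : l z = a) (hd : ∀ k, f k z = b k → f k d ≤ 0) : l d ≤ 0 := by
  obtain ⟨ε, h1, h2⟩ := exists_pos_step hz hd
  have := hl _ h2
  simp only [map_add, map_smul, smul_eq_mul] at this
  by_contra! h
  nlinarith [mul_pos h1 h]

lemma eq_zero_of_max [Finite K] {l : E →ₗ[ℝ] ℝ} {a : ℝ} (hl : ∀ y ∈ hpoly f b, l y ≤ a) {z d : E}
    (hz : z ∈ hpoly f b) (ha : l z = a) (hd : ∀ k, f k z = b k → f k d = 0) : l d = 0 := by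
  have h1 := le_zero_of_max hl hz ha (d := d) fun k hk => (hd k hk).le
  have h2 := le_zero_of_max hl hz ha (d := -d) fun k hk => by simp [hd k hk]
  simp only [map_neg] at h2
  linarith

/-- At a strictly feasible point every direction is admissible. This is the source of the
contradictions in the necessity part: a nonzero supporting functional cannot attain its maximum in
the interior. -/
lemma functional_eq_zero_of_max [Finite K] {l : E →ₗ[ℝ] ℝ} {a : ℝ}
    (hl : ∀ y ∈ hpoly f b, l y ≤ a) {z : E} (hz : ∀ k, f k z < b k) (ha : l z = a) : l = 0 := by
  ext d
  exact eq_zero_of_max hl (fun k => (hz k).le) ha fun k hk => absurd hk (hz k).ne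

/-- Any direction killed by the tight functionals can be followed a little from `z` within the face,
so dimensions of faces reduce to ranks of the tight functionals. -/
lemma vectorSpan_hface_tight [Finite K] {z : E} (hz : z ∈ hpoly f b) :
    vectorSpan ℝ (hface f b (tight f b z)) = ⨅ k ∈ tight f b z, LinearMap.ker (f k) := by
  apply le_antisymm
  · rw [vectorSpan, Submodule.span_le]
    rintro _ ⟨x, hx, y, hy, rfl⟩
    simp only [SetLike.mem_coe, Submodule.mem_iInf, LinearMap.mem_ker]
    intro k hk
    simp [hx.2 k hk, hy.2 k hk]
  · intro d hd
    simp only [Submodule.mem_iInf, LinearMap.mem_ker] at hd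
    obtain ⟨ε, h1, h2⟩ := exists_pos_step (f := f) (b := b) (d := d) hz fun k hk => (hd k hk).le
    have h3 : z + ε • d ∈ hface f b (tight f b z) := by
      refine ⟨h2, fun k hk => ?_⟩
      simp only [map_add, map_smul, hd k hk, smul_zero, add_zero]
      exact hk
    have h4 : z ∈ hface f b (tight f b z) := ⟨hz, fun k hk => hk⟩
    have h5 := vsub_mem_vectorSpan ℝ h3 h4
    rw [vsub_eq_sub, add_sub_cancel_left] at h5
    simpa [smul_smul, h1.ne'] using Submodule.smul_mem _ ε⁻¹ h5

lemma vectorSpan_hface [Finite K] {S : Set K} {z : E} (hz : z ∈ hpoly f b)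
    (hS : tight f b z = S) :
    vectorSpan ℝ (hface f b S) = ⨅ k ∈ S, LinearMap.ker (f k) := by
  subst hS; exact vectorSpan_hface_tight hz

lemma vectorSpan_hpoly [Finite K] {z : E} (hz : ∀ k, f k z < b k) :
    vectorSpan ℝ (hpoly f b) = ⊤ := by
  rw [← hface_empty, vectorSpan_hface (fun k => (hz k).le) (z := z)]
  · simp
  · ext k; simp [tight, (hz k).ne]

/-- In a convex subset of a polyhedron some point is tight only where the whole subset is. -/
lemma exists_generic [Finite K] {C : Set E} (hC : Convex ℝ C) (hne : C.Nonempty)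
    (hsub : C ⊆ hpoly f b) : ∃ z ∈ C, ∀ k, f k z = b k → ∀ x ∈ C, f k x = b k := by
  classical
  have := Fintype.ofFinite K
  suffices h : ∀ s : Finset K, ∃ z ∈ C, ∀ k ∈ s, f k z = b k → ∀ x ∈ C, f k x = b k by
    obtain ⟨z, hz, h⟩ := h Finset.univ
    exact ⟨z, hz, fun k => h k (Finset.mem_univ k)⟩
  intro s
  induction s using Finset.induction_on with
  | empty => exact ⟨hne.some, hne.some_mem, by simp⟩
  | insert k s _ ih =>
    obtain ⟨z, hz, h⟩ := ih
    by_cases hk : ∀ x ∈ C, f k x = b k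
    · refine ⟨z, hz, fun j hj => ?_⟩
      rcases Finset.mem_insert.1 hj with rfl | hj
      · exact fun _ => hk
      · exact h j hj
    · push Not at hk
      obtain ⟨x, hx, hxk⟩ := hk
      -- An inequality tight at a midpoint of two feasible points is tight at both, so passing to
      -- the midpoint makes `k` slack and creates no new tightness.
      refine ⟨(1 / 2 : ℝ) • z + (1 / 2 : ℝ) • x,
        hC hz hx (by norm_num) (by norm_num) (by norm_num), fun j hj hj2 => ?_⟩
      simp only [map_add, map_smul, smul_eq_mul] at hj2
      have hzj := hsub hz j
      have hxj := hsub hx j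
      rcases Finset.mem_insert.1 hj with rfl | hj
      · exact absurd (by linarith) hxk
      · exact h j hj (by linarith)

lemma convex_face {P F : Set E} (hP : Convex ℝ P) {l : E →ₗ[ℝ] ℝ} {a : ℝ}
    (h : CutsOut P F l a) : Convex ℝ F := by
  rw [h.2]
  exact hP.inter (convex_hyperplane l.isLinear a)

/-- A generic point `z` of `F` plays the role of a relative interior point: `l` has no slope along
directions killed by the functionals tight at `z`, so `F` contains all points sharing that
tightness. -/
lemma exists_tight_of_cutsOut [Finite K] {F : Set E} {l : E →ₗ[ℝ] ℝ} {a : ℝ}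
    (hF : CutsOut (hpoly f b) F l a) (hne : F.Nonempty) :
    ∃ z ∈ F, F = hface f b (tight f b z) := by
  have hsub : F ⊆ hpoly f b := by rw [hF.2]; exact fun x hx => hx.1
  obtain ⟨z, hz, h⟩ := exists_generic (convex_face convex_hpoly hF) hne hsub
  refine ⟨z, hz, Set.Subset.antisymm (fun x hx => ⟨hsub hx, fun k hk => h k hk x hx⟩) ?_⟩
  intro x hx
  have hz2 : l z = a := by rw [hF.2] at hz; exact hz.2
  have := eq_zero_of_max hF.1 (hsub hz) hz2 (d := x - z) fun k hk => by
    rw [map_sub, hx.2 k hk, hk, sub_self]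
  rw [hF.2]
  exact ⟨hx.1, by rw [map_sub] at this; linarith⟩

/-- The sum of the inequalities in `S` is tight exactly when each of them is. -/
lemma isFace_hface [Finite K] (S : Set K) : IsFace (hpoly f b) (hface f b S) := by
  classical
  have := Fintype.ofFinite K
  refine ⟨∑ k ∈ S.toFinset, f k, ∑ k ∈ S.toFinset, b k, fun y hy => ?_, ?_⟩
  · rw [LinearMap.sum_apply]
    exact Finset.sum_le_sum fun k _ => hy k
  · ext y
    constructor
    · rintro ⟨h1, h2⟩
      refine ⟨h1, ?_⟩
      rw [LinearMap.sum_apply]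
      exact Finset.sum_congr rfl fun k hk => h2 k (by simpa using hk)
    · rintro ⟨h1, h2⟩
      refine ⟨h1, fun k hk => ?_⟩
      rw [LinearMap.sum_apply, Finset.sum_eq_sum_iff_of_le fun k _ => h1 k] at h2
      exact h2 k (by simpa using hk)

lemma finrank_ker_functional [FiniteDimensional ℝ E] {l : E →ₗ[ℝ] ℝ} (hl : l ≠ 0) :
    Module.finrank ℝ (LinearMap.ker l) + 1 = Module.finrank ℝ E := by
  have := LinearMap.finrank_range_add_finrank_ker l
  rw [LinearMap.range_eq_top.2 (LinearMap.surjective hl), finrank_top, Module.finrank_self] at this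
  omega

/-- The vector `d` certifies that `l'` is not a multiple of `l`. -/
lemma finrank_ker_inf_ker [FiniteDimensional ℝ E] {l l' : E →ₗ[ℝ] ℝ} (hl : l ≠ 0)
    {d : E} (hd : l d = 0) (hd' : l' d ≠ 0) :
    Module.finrank ℝ ↥(LinearMap.ker l ⊓ LinearMap.ker l') + 2 = Module.finrank ℝ E := by
  have h1 := finrank_ker_functional hl
  have h2 := finrank_ker_functional (l := l') (by rintro rfl; simp at hd')
  have h3 := Submodule.finrank_sup_add_finrank_inf_eq (LinearMap.ker l) (LinearMap.ker l')
  have h4 := Submodule.finrank_le (LinearMap.ker l ⊔ LinearMap.ker l')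
  have h5 : LinearMap.ker l ⊓ LinearMap.ker l' < LinearMap.ker l := by
    refine lt_of_le_of_ne inf_le_left fun h => hd' ?_
    have : d ∈ LinearMap.ker l ⊓ LinearMap.ker l' := by rw [h]; exact hd
    exact this.2
  have h6 := Submodule.finrank_lt_finrank_of_lt h5
  omega

lemma dim_hpoly [Finite K] {o : E} (ho : ∀ k, f k o < b k) :
    dim (hpoly f b) = Module.finrank ℝ E := by
  rw [dim, vectorSpan_hpoly ho, finrank_top]

lemma isFacet_hface [Finite K] [FiniteDimensional ℝ E] {o : E} (ho : ∀ k, f k o < b k)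
    {k : K} {z : E} (hz : z ∈ hpoly f b) (hk : tight f b z = {k}) :
    IsFacet (hpoly f b) (hface f b {k}) := by
  have hkz : f k z = b k := by
    have : k ∈ tight f b z := by rw [hk]; rfl
    exact this
  refine ⟨⟨z, hz, by simpa using hkz⟩, isFace_hface _, ?_⟩
  rw [dim_hpoly ho, dim, vectorSpan_hface hz hk]
  rw [iInf_singleton]
  apply finrank_ker_functional
  intro h
  have := ho k
  rw [← hkz, h] at this
  simp at this

/-- Codimension one forces the common kernel of the functionals tight at a generic point to equal
the kernel of a single one of them. -/
lemma exists_eq_hface_of_isFacet [Finite K] [FiniteDimensional ℝ E] {o : E}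
    (ho : ∀ k, f k o < b k) {F : Set E} (hF : IsFacet (hpoly f b) F) :
    ∃ k, F = hface f b {k} := by
  obtain ⟨hne, ⟨l, a, hl⟩, hd⟩ := hF
  obtain ⟨z, hz, hFz⟩ := exists_tight_of_cutsOut hl hne
  have hzP : z ∈ hpoly f b := by rw [hFz] at hz; exact hz.1
  rw [dim_hpoly ho, dim, hFz, vectorSpan_hface_tight hzP] at hd
  have hS : (tight f b z).Nonempty := by
    by_contra! h
    rw [h, iInf_emptyset, finrank_top] at hd
    omega
  obtain ⟨k, hk⟩ := hS
  have hk0 : f k ≠ 0 := by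
    intro h
    have h1 := ho k
    rw [← show f k z = b k from hk, h] at h1
    simp at h1
  have hle : ⨅ j ∈ tight f b z, LinearMap.ker (f j) ≤ LinearMap.ker (f k) := iInf₂_le k hk
  have heq := Submodule.eq_of_le_of_finrank_eq hle (by have := finrank_ker_functional hk0; omega)
  refine ⟨k, ?_⟩
  rw [hFz]
  apply Set.Subset.antisymm
  · exact fun x hx => ⟨hx.1, by rintro _ rfl; exact hx.2 _ hk⟩
  · intro x hx
    refine ⟨hx.1, fun j hj => ?_⟩
    have : x - z ∈ LinearMap.ker (f k) := by
      simp [hx.2 k rfl, show f k z = b k from hk]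
    rw [← heq] at this
    simp only [Submodule.mem_iInf, LinearMap.mem_ker] at this
    have := this j hj
    rw [map_sub, show f j z = b j from hj] at this
    linarith

lemma isRidge_hface [Finite K] [FiniteDimensional ℝ E] {o : E} (ho : ∀ k, f k o < b k)
    {j k : K} (hjk : j ≠ k) {z y : E} (hz : z ∈ hpoly f b) (hkz : tight f b z = {j, k})
    (hy : tight f b y = {j}) : IsRidge (hpoly f b) (hface f b {j, k}) := by
  have h1 : f j z = b j := by
    have : j ∈ tight f b z := by rw [hkz]; simp
    exact this
  have h2 : f k z = b k := by
    have : k ∈ tight f b z := by rw [hkz]; simp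
    exact this
  have h3 : f j y = b j := by
    have : j ∈ tight f b y := by rw [hy]; simp
    exact this
  have h4 : f k y ≠ b k := by
    intro h
    have : k ∈ tight f b y := h
    rw [hy] at this
    exact hjk this.symm
  refine ⟨⟨z, hz, by simp [h1, h2]⟩, isFace_hface _, ?_⟩
  rw [dim_hpoly ho, dim, vectorSpan_hface hz hkz, iInf_pair]
  apply finrank_ker_inf_ker (d := y - z)
  · intro h
    have := ho j
    rw [← h1, h] at this
    simp at this
  · simp [h1, h3]
  · rw [map_sub, h2]; exact sub_ne_zero.2 h4

/-- If only one inequality were tight at a generic point, the codimension would be one. Irredundancy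
`hfac` makes any two different functionals tight there independent, so two already cut out the
ridge. -/
lemma exists_eq_hface_of_isRidge [Finite K] [FiniteDimensional ℝ E] {o : E}
    (ho : ∀ k, f k o < b k) (hfac : ∀ k, ∃ y ∈ hpoly f b, tight f b y = {k})
    {R : Set E} (hR : IsRidge (hpoly f b) R) :
    ∃ j k, j ≠ k ∧ R = hface f b {j, k} ∧ R.Nonempty := by
  obtain ⟨hne, ⟨l, a, hl⟩, hd⟩ := hR
  obtain ⟨z, hz, hRz⟩ := exists_tight_of_cutsOut hl hne
  have hzP : z ∈ hpoly f b := by rw [hRz] at hz; exact hz.1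
  rw [dim_hpoly ho, dim, hRz, vectorSpan_hface_tight hzP] at hd
  have hS : (tight f b z).Nonempty := by
    by_contra! h
    rw [h, iInf_emptyset, finrank_top] at hd
    omega
  obtain ⟨j, hj⟩ := hS
  have hj0 : f j ≠ 0 := by
    intro h
    have h1 := ho j
    rw [← show f j z = b j from hj, h] at h1
    simp at h1
  have hS2 : ∃ k ∈ tight f b z, k ≠ j := by
    by_contra! h
    have : tight f b z = {j} := Set.eq_singleton_iff_unique_mem.2 ⟨hj, h⟩
    rw [this] at hd
    rw [iInf_singleton] at hd
    have := finrank_ker_functional hj0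
    omega
  obtain ⟨k, hk, hkj⟩ := hS2
  obtain ⟨y, hy, hyj⟩ := hfac j
  have h3 : f j y = b j := by
    have : j ∈ tight f b y := by rw [hyj]; simp
    exact this
  have h4 : f k y ≠ b k := by
    intro h
    have : k ∈ tight f b y := h
    rw [hyj] at this
    exact hkj this
  have hrank := finrank_ker_inf_ker hj0 (l' := f k) (d := y - z)
    (by rw [map_sub, h3, show f j z = b j from hj, sub_self])
    (by rw [map_sub, show f k z = b k from hk]; exact sub_ne_zero.2 h4)
  have hle : ⨅ i ∈ tight f b z, LinearMap.ker (f i) ≤ LinearMap.ker (f j) ⊓ LinearMap.ker (f k) :=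
    le_inf (iInf₂_le j hj) (iInf₂_le k hk)
  have heq := Submodule.eq_of_le_of_finrank_eq hle (by omega)
  refine ⟨j, k, hkj.symm, ?_, hne⟩
  rw [hRz]
  apply Set.Subset.antisymm
  · refine fun x hx => ⟨hx.1, ?_⟩
    rintro _ (rfl | rfl)
    exacts [hx.2 _ hj, hx.2 _ hk]
  · intro x hx
    refine ⟨hx.1, fun i hi => ?_⟩
    have : x - z ∈ LinearMap.ker (f j) ⊓ LinearMap.ker (f k) := by
      simp [hx.2 j (by simp), show f j z = b j from hj, hx.2 k (by simp),
        show f k z = b k from hk]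
    rw [← heq] at this
    simp only [Submodule.mem_iInf, LinearMap.mem_ker] at this
    have := this i hi
    rw [map_sub, show f i z = b i from hi] at this
    linarith

/-- The inequality of a facet is unique up to positive scaling. -/
lemma exists_smul_of_cutsOut [Finite K] {o : E} (ho : ∀ k, f k o < b k)
    {k : K} {z : E} (hz : z ∈ hpoly f b) (hk : tight f b z = {k}) {l : E →ₗ[ℝ] ℝ} {a : ℝ}
    (hl : CutsOut (hpoly f b) (hface f b {k}) l a) :
    ∃ t : ℝ, 0 < t ∧ (∀ x, l x = t * f k x) ∧ a = t * b k := by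
  have hkz : f k z = b k := by
    have : k ∈ tight f b z := by rw [hk]; rfl
    exact this
  have hza : l z = a := by
    have : z ∈ hface f b {k} := ⟨hz, by simpa using hkz⟩
    rw [hl.2] at this
    exact this.2
  have hker : ∀ d, f k d = 0 → l d = 0 := fun d hd =>
    eq_zero_of_max hl.1 hz hza fun j hj => by
      have : j ∈ tight f b z := hj
      rw [hk] at this
      rwa [show j = k from this]
  have hoz : f k (z - o) ≠ 0 := by rw [map_sub, hkz]; exact (sub_pos.2 (ho k)).ne'
  -- `l` vanishes on the kernel of `f k`, hence is a multiple of it; the factor is read off on `z -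
  -- o`, which points from the interior to the facet.
  have hform : ∀ x, l x = (l (z - o) / f k (z - o)) * f k x := by
    intro x
    have := hker (x - (f k x / f k (z - o)) • (z - o)) (by
      rw [map_sub, map_smul, smul_eq_mul, div_mul_cancel₀ _ hoz, sub_self])
    rw [map_sub, map_smul, smul_eq_mul] at this
    field_simp at this ⊢
    linarith
  refine ⟨_, ?_, hform, ?_⟩
  · apply div_pos
    · have h1 : l o < a := by
        refine lt_of_le_of_ne (hl.1 o fun k => (ho k).le) fun h => ?_
        have : o ∈ hface f b {k} := by rw [hl.2]; exact ⟨fun k => (ho k).le, h⟩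
        exact (ho k).ne (this.2 k rfl)
      rw [map_sub, hza]; linarith
    · rw [map_sub, hkz]; linarith [ho k]
  · rw [← hkz, ← hform, hza]

lemma cutsOut_hface (k : K) : CutsOut (hpoly f b) (hface f b {k}) (f k) (b k) := by
  refine ⟨fun y hy => hy k, ?_⟩
  ext y
  simp [hface]

lemma hface_singleton_injective (hfac : ∀ k, ∃ y ∈ hpoly f b, tight f b y = {k}) :
    Function.Injective fun k => hface f b {k} := by
  intro j k h
  obtain ⟨y, hy, hyj⟩ := hfac j
  have h1 : y ∈ hface f b {j} := by
    refine ⟨hy, fun i hi => ?_⟩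
    have : i ∈ tight f b y := by rw [hyj]; exact hi
    exact this
  have h2 : y ∈ hface f b {k} := by
    have h' : hface f b {j} = hface f b {k} := h
    rwa [← h']
  have : k ∈ tight f b y := h2.2 k rfl
  rw [hyj] at this
  exact this.symm

/-- Beyondness of a facet of a full-dimensional polyhedron in terms of its given inequalities. -/
lemma isBeyond_hface_iff [Finite K] [FiniteDimensional ℝ E] {o : E} (ho : ∀ k, f k o < b k)
    (hfac : ∀ k, ∃ y ∈ hpoly f b, tight f b y = {k}) (k : K) (x : E) :
    IsBeyond (hpoly f b) (hface f b {k}) x ↔ b k < f k x ∧ ∀ j, j ≠ k → f j x < b j := by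
  constructor
  · rintro ⟨⟨l, a, hl, hx⟩, h⟩
    constructor
    · obtain ⟨z, hz, hk⟩ := hfac k
      obtain ⟨t, ht, h1, h2⟩ := exists_smul_of_cutsOut ho hz hk hl
      rw [h1, h2] at hx
      exact lt_of_mul_lt_mul_left hx ht.le
    · intro j hj
      obtain ⟨z, hz, hk⟩ := hfac j
      obtain ⟨l, a, hl, hx⟩ := h _ (isFacet_hface ho hz hk)
        fun h => hj (hface_singleton_injective hfac h)
      obtain ⟨t, ht, h1, h2⟩ := exists_smul_of_cutsOut ho hz hk hl
      rw [h1, h2] at hx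
      exact lt_of_mul_lt_mul_left hx ht.le
  · rintro ⟨h1, h2⟩
    refine ⟨⟨_, _, cutsOut_hface k, h1⟩, fun G hG hGk => ?_⟩
    obtain ⟨j, rfl⟩ := exists_eq_hface_of_isFacet ho hG
    exact ⟨_, _, cutsOut_hface j, h2 j fun h => hGk (by rw [h])⟩

end Polyhedra

/-! ### Recognising the E-construction from inequality descriptions. -/

section Criterion

variable {E : Type*} [AddCommGroup E] [Module ℝ E] {K L : Type*}

/-- A face of `P ∪ {pt k}` is the union of the pyramids over the face of `P`. -/
lemma hface_eq_mergedFacet [Finite K] [FiniteDimensional ℝ E]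
    {f : K → E →ₗ[ℝ] ℝ} {b : K → ℝ} {g : L → E →ₗ[ℝ] ℝ} {c : L → ℝ} {pt : K → E}
    {T : Set K} {o : E} (ho : ∀ k, f k o < b k)
    (hfac : ∀ k, ∃ y ∈ hpoly f b, tight f b y = {k})
    {v : Set E → E} (hv : ∀ k, v (hface f b {k}) = pt k)
    (hTne : T.Nonempty) (hT : ∃ z ∈ hpoly f b, tight f b z = T) (r : L)
    (hPQ : hpoly f b ⊆ hpoly g c) (hptQ : ∀ k, pt k ∈ hpoly g c)
    (hg : ∀ x ∈ hpoly f b, g r x = c r ↔ ∀ k ∈ T, f k x = b k)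
    (hp : ∀ k, g r (pt k) = c r ↔ k ∈ T)
    (hdec : ∀ x ∈ hpoly g c, ∃ k, ∃ z ∈ hpoly f b, x ∈ segment ℝ (pt k) z) :
    hface g c {r} = mergedFacet (hpoly f b) v (hface f b T) := by
  obtain ⟨z₀, hz₀, hzT⟩ := hT
  have hz₀' : z₀ ∈ hface f b T := ⟨hz₀, fun k hk => by rw [← hzT] at hk; exact hk⟩
  have hmem : ∀ x, x ∈ mergedFacet (hpoly f b) v (hface f b T) ↔
      ∃ k ∈ T, ∃ z ∈ hface f b T, x ∈ segment ℝ (pt k) z := by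
    intro x
    have hconv : Convex ℝ (hface f b T) := by
      obtain ⟨l, a, h⟩ := isFace_hface (f := f) (b := b) T
      exact convex_face convex_hpoly h
    simp only [mergedFacet, Set.mem_iUnion, Set.mem_ofPred_eq, exists_prop]
    constructor
    · rintro ⟨F, ⟨hF, hTF⟩, hx⟩
      obtain ⟨k, rfl⟩ := exists_eq_hface_of_isFacet ho hF
      rw [convexHull_insert ⟨z₀, hz₀'⟩, hconv.convexHull_eq, mem_convexJoin, hv] at hx
      obtain ⟨_, rfl, z, hz, hx⟩ := hx
      refine ⟨k, ?_, z, hz, hx⟩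
      rw [← hzT]
      exact (hTF hz₀').2 k rfl
    · rintro ⟨k, hk, z, hz, hx⟩
      obtain ⟨y, hy, hyk⟩ := hfac k
      refine ⟨hface f b {k}, ⟨isFacet_hface ho hy hyk, fun w hw => ⟨hw.1, ?_⟩⟩, ?_⟩
      · rintro _ rfl
        exact hw.2 _ hk
      · rw [convexHull_insert ⟨z₀, hz₀'⟩, hconv.convexHull_eq, mem_convexJoin, hv]
        exact ⟨_, rfl, z, hz, hx⟩
  ext x
  rw [hmem]
  constructor
  · rintro ⟨hxQ, hxr⟩
    replace hxr := hxr r rfl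
    obtain ⟨k, z, hz, s, t, hs, ht, hst, rfl⟩ := hdec x hxQ
    rw [map_add, map_smul, map_smul, smul_eq_mul, smul_eq_mul] at hxr
    have h1 := hPQ hz r
    have h2 := hptQ k r
    -- A convex combination attains the maximum of `g r` only if every end with positive weight
    -- does. The degenerate weights 0 and 1 need an arbitrary element of `T`, respectively an
    -- arbitrary point of the ridge, to supply the missing end.
    rcases hs.eq_or_lt with rfl | hs
    · obtain rfl : t = 1 := by linarith
      obtain ⟨j, hj⟩ := hTne
      refine ⟨j, hj, z, ⟨hz, (hg z hz).1 (by linarith)⟩, 0, 1, le_rfl, zero_le_one, by norm_num, ?_⟩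
      simp
    · have h3 : g r (pt k) = c r := by
        have : s = 1 - t := by linarith
        subst this
        nlinarith
      have hkT := (hp k).1 h3
      rcases ht.eq_or_lt with rfl | ht
      · obtain rfl : s = 1 := by linarith
        exact ⟨k, hkT, z₀, hz₀', 1, 0, zero_le_one, le_rfl, by norm_num, by simp⟩
      · have h4 : g r z = c r := by
          have : s = 1 - t := by linarith
          subst this
          nlinarith
        exact ⟨k, hkT, z, ⟨hz, (hg z hz).1 h4⟩, s, t, hs.le, ht.le, hst, rfl⟩
  · rintro ⟨k, hk, z, hz, hx⟩
    refine ⟨convex_hpoly.segment_subset (hptQ k) (hPQ hz.1) hx, ?_⟩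
    rintro _ rfl
    obtain ⟨s, t, hs, ht, hst, rfl⟩ := hx
    rw [map_add, map_smul, map_smul, smul_eq_mul, smul_eq_mul, (hp k).2 hk,
      (hg z hz.1).2 hz.2, ← add_mul, hst, one_mul]

/-- A criterion for vertex-preserving realisations in terms of inequality descriptions: the
functionals `g r` are those of the facets of the realisation, and `T r` is the pair of facets that
meet in the ridge belonging to `r`. -/
theorem isVertexPreservingE_hpoly [Finite K] [Finite L] [FiniteDimensional ℝ E]
    {f : K → E →ₗ[ℝ] ℝ} {b : K → ℝ} {g : L → E →ₗ[ℝ] ℝ} {c : L → ℝ} {pt : K → E}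
    {T : L → Set K} {o : E} (ho : ∀ k, f k o < b k) (ho' : ∀ r, g r o < c r)
    (hfac : ∀ k, ∃ y ∈ hpoly f b, tight f b y = {k})
    (hridge : ∀ R, IsRidge (hpoly f b) R ↔ ∃ r, R = hface f b (T r))
    (hTne : ∀ r, (T r).Nonempty) (hT : ∀ r, ∃ z ∈ hpoly f b, tight f b z = T r)
    (hbeyond : ∀ k, b k < f k (pt k)) (hother : ∀ k j, j ≠ k → f j (pt k) < b j)
    (hPQ : hpoly f b ⊆ hpoly g c) (hptQ : ∀ k, pt k ∈ hpoly g c)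
    (hg : ∀ r, ∀ x ∈ hpoly f b, g r x = c r ↔ ∀ k ∈ T r, f k x = b k)
    (hp : ∀ r k, g r (pt k) = c r ↔ k ∈ T r)
    (hdec : ∀ x ∈ hpoly g c, ∃ k, ∃ z ∈ hpoly f b, x ∈ segment ℝ (pt k) z)
    (hgfac : ∀ r, ∃ y ∈ hpoly g c, tight g c y = {r})
    {v : Set E → E} (hv : ∀ k, v (hface f b {k}) = pt k) :
    IsVertexPreservingE (hpoly f b) v (hpoly g c) := by
  have hfacet : ∀ k, IsFacet (hpoly f b) (hface f b {k}) := fun k => by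
    obtain ⟨y, hy, hyk⟩ := hfac k
    exact isFacet_hface ho hy hyk
  have hmerged : ∀ r, hface g c {r} = mergedFacet (hpoly f b) v (hface f b (T r)) := fun r =>
    hface_eq_mergedFacet ho hfac hv (hTne r) (hT r) r hPQ hptQ (hg r) (hp r) hdec
  refine ⟨fun F hF => ?_, ?_, fun G => ?_⟩
  · obtain ⟨k, rfl⟩ := exists_eq_hface_of_isFacet ho hF
    rw [isBeyond_hface_iff ho hfac, hv]
    exact ⟨hbeyond k, hother k⟩
  · apply Set.Subset.antisymm
    · intro x hx
      obtain ⟨k, z, hz, hx⟩ := hdec x hx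
      refine (convex_convexHull ℝ _).segment_subset ?_ ?_ hx
      · exact subset_convexHull ℝ _ (Or.inr ⟨_, hfacet k, hv k⟩)
      · exact subset_convexHull ℝ _ (Or.inl hz)
    · refine convexHull_min (Set.union_subset hPQ ?_) convex_hpoly
      rintro _ ⟨F, hF, rfl⟩
      obtain ⟨k, rfl⟩ := exists_eq_hface_of_isFacet ho hF
      rw [hv]
      exact hptQ k
  · constructor
    · intro hG
      obtain ⟨r, rfl⟩ := exists_eq_hface_of_isFacet ho' hG
      exact ⟨_, (hridge _).2 ⟨r, rfl⟩, hmerged r⟩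
    · rintro ⟨R, hR, rfl⟩
      obtain ⟨r, rfl⟩ := (hridge R).1 hR
      rw [← hmerged]
      obtain ⟨y, hy, hyr⟩ := hgfac r
      exact isFacet_hface ho' hy hyr

end Criterion

/-! ### Cosines of equally spaced angles. -/

section Angles

variable {m : ℕ}

/-- The angle of the `i`-th vertex of a regular `m`-gon. -/
noncomputable def ang (i : ZMod m) : ℝ := 2 * Real.pi * i.val / m

lemma ang_zero : ang (0 : ZMod m) = 0 := by simp [ang]

lemma ang_one (hm : 3 ≤ m) : ang (1 : ZMod m) = 2 * Real.pi / m := by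
  have : Fact (1 < m) := ⟨by omega⟩
  simp [ang, ZMod.val_one]

lemma pi_div_pos (hm : 3 ≤ m) : 0 < Real.pi / m :=
  div_pos Real.pi_pos (by exact_mod_cast (by omega : 0 < m))

lemma pi_div_le (hm : 3 ≤ m) : Real.pi / m ≤ Real.pi / 3 :=
  div_le_div_of_nonneg_left Real.pi_pos.le (by norm_num) (by exact_mod_cast hm)

lemma cos_pi_div_pos (hm : 3 ≤ m) : 0 < Real.cos (Real.pi / m) := by
  apply Real.cos_pos_of_mem_Ioo
  have := pi_div_pos hm
  have := pi_div_le hm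
  have := Real.pi_pos
  constructor <;> linarith

lemma cos_lt_cos_of_between {δ x : ℝ} (hδ : 0 ≤ δ) (h1 : δ < x)
    (h2 : x < 2 * Real.pi - δ) : Real.cos x < Real.cos δ := by
  rcases le_total x Real.pi with h | h
  · exact Real.cos_lt_cos_of_nonneg_of_le_pi hδ h h1
  · rw [← Real.cos_two_pi_sub x]
    exact Real.cos_lt_cos_of_nonneg_of_le_pi hδ (by linarith) (by linarith)

lemma cos_pi_div_lt {γ : ℝ} (hm : 3 ≤ m) (h : |γ| < Real.pi / m) :
    Real.cos (Real.pi / m) < Real.cos γ := by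
  rw [← Real.cos_abs γ]
  have := pi_div_le hm
  have := Real.pi_pos
  exact Real.cos_lt_cos_of_nonneg_of_le_pi (abs_nonneg _) (by linarith) h

variable [NeZero m]

/-- `ang` uses the representative in `[0, m)` and so is additive only modulo 2π; the cosine does not
see the difference. Index arithmetic in `ZMod m` enters the cosines through this identity. -/
lemma cos_add_ang_sub_ang (γ : ℝ) (i j : ZMod m) :
    Real.cos (γ + ang i - ang j) = Real.cos (γ + ang (i - j)) := by
  have h : (((i.val : ℤ) - j.val - (i - j).val : ℤ) : ZMod m) = 0 := by
    push_cast
    simp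
  rw [ZMod.intCast_zmod_eq_zero_iff_dvd _ m] at h
  obtain ⟨t, ht⟩ := h
  have h2 : (i.val : ℝ) - j.val = (i - j).val + m * t := by
    have : ((i.val : ℤ) - j.val - (i - j).val : ℝ) = ((m * t : ℤ) : ℝ) := by
      exact_mod_cast congrArg (Int.cast : ℤ → ℝ) ht
    push_cast at this
    linarith
  have hm : (m : ℝ) ≠ 0 := NeZero.ne _
  have h3 : γ + ang i - ang j = γ + ang (i - j) + t * (2 * Real.pi) := by
    have : ang i - ang j = 2 * Real.pi * ((i.val : ℝ) - j.val) / m := by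
      unfold ang; ring
    rw [add_sub_assoc, this, h2]
    unfold ang
    field_simp
    ring
  rw [h3, Real.cos_add_int_mul_two_pi]

lemma cos_add_ang_add_one (hm : 3 ≤ m) (γ : ℝ) (i : ZMod m) :
    Real.cos (γ + ang (i + 1)) = Real.cos (γ + 2 * Real.pi / m + ang i) := by
  have := cos_add_ang_sub_ang (γ + 2 * Real.pi / m) (i + 1) 1
  rw [add_sub_cancel_right] at this
  rw [← this, ang_one hm]
  ring_nf

lemma cos_add_ang_neg_one (hm : 3 ≤ m) (γ : ℝ) :
    Real.cos (γ + ang (-1 : ZMod m)) = Real.cos (γ - 2 * Real.pi / m) := by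
  have := cos_add_ang_sub_ang γ (0 : ZMod m) 1
  rw [zero_sub] at this
  rw [← this, ang_one hm, ang_zero, add_zero]

lemma ang_bounds {k : ZMod m} (hk : k ≠ 0) :
    2 * (Real.pi / m) ≤ ang k ∧ ang k ≤ 2 * Real.pi - 2 * (Real.pi / m) := by
  have h1 : 1 ≤ k.val := Nat.one_le_iff_ne_zero.2 ((ZMod.val_ne_zero k).2 hk)
  have h2 : k.val + 1 ≤ m := ZMod.val_lt k
  have hm : (0 : ℝ) < m := by exact_mod_cast NeZero.pos m
  have h1' : (1 : ℝ) ≤ k.val := by exact_mod_cast h1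
  have h2' : (k.val : ℝ) + 1 ≤ m := by exact_mod_cast h2
  have e : ang k = 2 * (Real.pi / m) * k.val := by unfold ang; ring
  have hp : 0 < Real.pi / m := div_pos Real.pi_pos hm
  have e2 : 2 * Real.pi = 2 * (Real.pi / m) * m := by field_simp
  rw [e]
  constructor
  · nlinarith
  · rw [e2]; nlinarith

lemma cos_add_ang_lt (hm : 3 ≤ m) {γ : ℝ} (h : |γ| < Real.pi / m) {k : ZMod m} (hk : k ≠ 0) :
    Real.cos (γ + ang k) < Real.cos (Real.pi / m) := by
  have := ang_bounds hk
  have := abs_lt.1 h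
  have := pi_div_pos hm
  have := pi_div_le hm
  have := Real.pi_pos
  exact cos_lt_cos_of_between (by linarith) (by linarith) (by linarith)

/-- Modulo 2π the angle is also `ang (k + 1) - π/m`, and `k + 1 ≠ 0` keeps it away from 2π. The
bound on `ang (k + 1)` alone would allow equality with π/m, which happens only for `k = 0`. -/
lemma cos_pi_div_add_ang_lt (hm : 3 ≤ m) {k : ZMod m} (hk : k ≠ 0) (hk' : k ≠ -1) :
    Real.cos (Real.pi / m + ang k) < Real.cos (Real.pi / m) := by
  have h1 := cos_add_ang_add_one hm (-(Real.pi / m)) k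
  rw [show -(Real.pi / m) + 2 * Real.pi / m + ang k = Real.pi / m + ang k by ring] at h1
  rw [← h1]
  have h2 : k + 1 ≠ 0 := fun h => hk' (eq_neg_of_add_eq_zero_left h)
  have := ang_bounds hk
  have := ang_bounds h2
  have := pi_div_pos hm
  have := pi_div_le hm
  have := Real.pi_pos
  rcases (ang_bounds h2).1.eq_or_lt with h | h
  · exfalso
    have hm0 : (0 : ℝ) < m := by exact_mod_cast NeZero.pos m
    have h5 : ((k + 1).val : ℝ) = 1 := by
      have e : ang (k + 1) = 2 * (Real.pi / m) * (k + 1).val := by unfold ang; ring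
      rw [e] at h
      nlinarith
    have h6 : (k + 1).val = 1 := by exact_mod_cast h5
    have : Fact (1 < m) := ⟨by omega⟩
    have h7 : k + 1 = 1 := by
      apply ZMod.val_injective
      rw [h6, ZMod.val_one]
    exact hk (by simpa using h7)
  · exact cos_lt_cos_of_between (by linarith) (by linarith) (by linarith)

lemma cos_pi_div_add_ang_neg_one (hm : 3 ≤ m) :
    Real.cos (Real.pi / m + ang (-1 : ZMod m)) = Real.cos (Real.pi / m) := by
  rw [cos_add_ang_neg_one hm, ← Real.cos_neg]
  ring_nf

lemma cos_pi_div_add_ang_eq_iff (hm : 3 ≤ m) {k : ZMod m} :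
    Real.cos (Real.pi / m + ang k) = Real.cos (Real.pi / m) ↔ k = 0 ∨ k = -1 := by
  constructor
  · intro h
    by_contra! h2
    exact (cos_pi_div_add_ang_lt hm h2.1 h2.2).ne h
  · rintro (rfl | rfl)
    · rw [ang_zero, add_zero]
    · exact cos_pi_div_add_ang_neg_one hm

lemma cos_pi_div_add_ang_le (hm : 3 ≤ m) (k : ZMod m) :
    Real.cos (Real.pi / m + ang k) ≤ Real.cos (Real.pi / m) := by
  by_cases h : k = 0 ∨ k = -1
  · exact ((cos_pi_div_add_ang_eq_iff hm).2 h).le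
  · push Not at h
    exact (cos_pi_div_add_ang_lt hm h.1 h.2).le

/-- With δ = 2π/m, the sum S(γ) is unchanged when γ is shifted by ±δ, while S(γ + δ) + S(γ - δ) = 2
cos δ · S(γ). Since cos δ < 1, S vanishes. -/
lemma sum_cos_add_ang (hm : 3 ≤ m) (γ : ℝ) : ∑ i : ZMod m, Real.cos (γ + ang i) = 0 := by
  have step : ∀ γ : ℝ, ∑ i : ZMod m, Real.cos (γ + 2 * Real.pi / m + ang i) =
      ∑ i : ZMod m, Real.cos (γ + ang i) := by
    intro γ
    rw [← Equiv.sum_comp (Equiv.addRight (1 : ZMod m)) fun i => Real.cos (γ + ang i)]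
    exact Finset.sum_congr rfl fun i _ => (cos_add_ang_add_one hm γ i).symm
  have h1 := step γ
  have h2 := step (γ - 2 * Real.pi / m)
  rw [sub_add_cancel] at h2
  have h3 : ∑ i : ZMod m, Real.cos (γ + 2 * Real.pi / m + ang i) +
      ∑ i : ZMod m, Real.cos (γ - 2 * Real.pi / m + ang i) =
      2 * Real.cos (2 * Real.pi / m) * ∑ i : ZMod m, Real.cos (γ + ang i) := by
    rw [← Finset.sum_add_distrib, Finset.mul_sum]
    refine Finset.sum_congr rfl fun i _ => ?_
    rw [show γ + 2 * Real.pi / m + ang i = (γ + ang i) + 2 * Real.pi / m by ring,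
      show γ - 2 * Real.pi / m + ang i = (γ + ang i) - 2 * Real.pi / m by ring,
      Real.cos_add, Real.cos_sub]
    ring
  have h4 : Real.cos (2 * Real.pi / m) < 1 := by
    rw [← Real.cos_zero]
    have := pi_div_le hm
    have := pi_div_pos hm
    have e : 2 * Real.pi / m = 2 * (Real.pi / m) := by ring
    rw [e]
    exact Real.cos_lt_cos_of_nonneg_of_le_pi le_rfl (by linarith [Real.pi_pos]) (by linarith)
  rw [h1, ← h2] at h3
  have h5 : (1 - Real.cos (2 * Real.pi / m)) * ∑ i : ZMod m, Real.cos (γ + ang i) = 0 := by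
    linarith
  rcases mul_eq_zero.1 h5 with h | h
  · linarith
  · exact h

end Angles

/-! ### Linear functionals on the Euclidean plane. -/

section Plane

/-- The linear functional `⟨e, ·⟩` for the unit vector `e` at angle `α`. -/
noncomputable def dirFun (α : ℝ) : EuclideanSpace ℝ (Fin 2) →ₗ[ℝ] ℝ where
  toFun x := Real.cos α * x 0 + Real.sin α * x 1
  map_add' x y := by simp; ring
  map_smul' t x := by simp; ring

/-- The unit vector at angle `α`. -/
noncomputable def dirVec (α : ℝ) : EuclideanSpace ℝ (Fin 2) := !₂[Real.cos α, Real.sin α]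

lemma dirFun_apply (α : ℝ) (x : EuclideanSpace ℝ (Fin 2)) :
    dirFun α x = Real.cos α * x 0 + Real.sin α * x 1 := rfl

lemma dirFun_dirVec (α β : ℝ) : dirFun α (dirVec β) = Real.cos (α - β) := by
  simp [dirFun_apply, dirVec, Real.cos_sub]

/-- Cramer's rule: the determinant of the two functionals is, up to sign, sin(α - β). -/
lemma eq_zero_of_dirFun_eq_zero {α β : ℝ} (h : Real.sin (α - β) ≠ 0)
    {d : EuclideanSpace ℝ (Fin 2)} (h1 : dirFun α d = 0) (h2 : dirFun β d = 0) : d = 0 := by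
  rw [dirFun_apply] at h1 h2
  rw [Real.sin_sub] at h
  ext i
  fin_cases i
  · have : (Real.sin α * Real.cos β - Real.cos α * Real.sin β) * d 0 = 0 := by
      linear_combination Real.sin α * h2 - Real.sin β * h1
    simpa [h] using this
  · have : (Real.sin α * Real.cos β - Real.cos α * Real.sin β) * d 1 = 0 := by
      linear_combination Real.cos β * h1 - Real.cos α * h2
    simpa [h] using this

lemma dist_eq_of_affine {x y q : EuclideanSpace ℝ (Fin 2)} {s t : ℝ} (ht : 0 ≤ t)
    (hst : s + t = 1) (hq : s • x + t • y = q) : dist x q = t * dist x y := by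
  have : x - q = t • (x - y) := by
    rw [← hq, show s = 1 - t by linarith]
    module
  rw [dist_eq_norm, dist_eq_norm, this, norm_smul, Real.norm_of_nonneg ht]

end Plane

/-! ### Regular polygons by vertices and by half-planes. -/

section Polygon

variable {m : ℕ}

/-- The `i`-th vertex of a regular `m`-gon. -/
noncomputable def vert (c : EuclideanSpace ℝ (Fin 2)) (ρ θ : ℝ) (i : ZMod m) :
    EuclideanSpace ℝ (Fin 2) := c + ρ • dirVec (θ + ang i)

/-- The outer normal of the edge from vertex `i` to vertex `i + 1` of a regular `m`-gon. -/
noncomputable def edgeFun (θ : ℝ) (i : ZMod m) : EuclideanSpace ℝ (Fin 2) →ₗ[ℝ] ℝ :=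
  dirFun (θ + Real.pi / m + ang i)

/-- The value of `edgeFun θ i` on the edge from vertex `i` to vertex `i + 1`. -/
noncomputable def edgeVal (c : EuclideanSpace ℝ (Fin 2)) (ρ θ : ℝ) (i : ZMod m) : ℝ :=
  edgeFun θ i c + ρ * Real.cos (Real.pi / m)

variable (m) in
/-- The regular `m`-gon with centre `c` and circumradius `ρ`, as an intersection of half-planes. -/
noncomputable def regPoly (c : EuclideanSpace ℝ (Fin 2)) (ρ θ : ℝ) :
    Set (EuclideanSpace ℝ (Fin 2)) := hpoly (edgeFun (m := m) θ) (edgeVal c ρ θ)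

lemma edgeVal_zero (ρ θ : ℝ) (i : ZMod m) : edgeVal 0 ρ θ i = ρ * Real.cos (Real.pi / m) := by
  simp [edgeVal]

lemma one_ne_zero_zmod (hm : 3 ≤ m) : (1 : ZMod m) ≠ 0 := by
  have : Fact (1 < m) := ⟨by omega⟩
  exact one_ne_zero

lemma two_ne_zero_zmod (hm : 3 ≤ m) : (2 : ZMod m) ≠ 0 := by
  intro h
  have : ((2 : ℕ) : ZMod m) = 0 := by exact_mod_cast h
  rw [ZMod.natCast_eq_zero_iff] at this
  have := Nat.le_of_dvd (by norm_num) this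
  omega

lemma edgeFun_center_lt {c : EuclideanSpace ℝ (Fin 2)} {ρ θ : ℝ} (hm : 3 ≤ m) (hρ : 0 < ρ) (k : ZMod m) :
    edgeFun θ k c < edgeVal c ρ θ k := by
  rw [edgeVal]
  have := mul_pos hρ (cos_pi_div_pos hm)
  linarith

variable [NeZero m]

lemma edgeFun_dirVec (θ γ : ℝ) (i j : ZMod m) : edgeFun θ i (dirVec (θ + γ + ang j)) =
    Real.cos (Real.pi / m - γ + ang (i - j)) := by
  rw [edgeFun, dirFun_dirVec, ← cos_add_ang_sub_ang]
  ring_nf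

lemma edgeFun_dirVec_zero (θ : ℝ) (i j : ZMod m) : edgeFun θ i (dirVec (θ + ang j)) =
    Real.cos (Real.pi / m + ang (i - j)) := by
  simpa using edgeFun_dirVec θ 0 i j

lemma edgeFun_vert (c : EuclideanSpace ℝ (Fin 2)) (ρ θ : ℝ) (i j : ZMod m) :
    edgeFun θ i (vert c ρ θ j) = edgeFun θ i c + ρ * Real.cos (Real.pi / m + ang (i - j)) := by
  rw [vert, map_add, map_smul, edgeFun_dirVec_zero, smul_eq_mul]

lemma eq_zero_of_edgeFun (hm : 3 ≤ m) {θ : ℝ} {i : ZMod m} {d : EuclideanSpace ℝ (Fin 2)}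
    (h1 : edgeFun θ i d = 0) (h2 : edgeFun θ (i - 1) d = 0) : d = 0 := by
  refine eq_zero_of_dirFun_eq_zero ?_ h1 h2
  rw [← Real.cos_pi_div_two_sub, ← Real.cos_neg]
  have := cos_add_ang_sub_ang (-(Real.pi / 2)) i (i - 1)
  rw [show -(Real.pi / 2 - (θ + Real.pi / m + ang i - (θ + Real.pi / m + ang (i - 1)))) =
    -(Real.pi / 2) + ang i - ang (i - 1) by ring, this, sub_sub_cancel, ang_one hm]
  have e : -(Real.pi / 2) + 2 * Real.pi / m = -(Real.pi / 2 - 2 * (Real.pi / m)) := by ring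
  rw [e, Real.cos_neg, Real.cos_pi_div_two_sub]
  apply ne_of_gt
  apply Real.sin_pos_of_pos_of_lt_pi
  · linarith [pi_div_pos hm]
  · linarith [pi_div_le hm, Real.pi_pos]

/-- Coordinates in the cone over edge `i` of the unit polygon, `M` being the scale. The functional
`i - 1` is maximal at the first end of the edge and determines `t`; the functional `i + 1` is
maximal at the other end and gives `0 ≤ s`. -/
lemma exists_edge_coords (hm : 3 ≤ m) {θ M : ℝ} {i : ZMod m}
    {y : EuclideanSpace ℝ (Fin 2)} (h0 : edgeFun θ i y = M * Real.cos (Real.pi / m))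
    (h1 : edgeFun θ (i - 1) y ≤ M * Real.cos (Real.pi / m))
    (h2 : edgeFun θ (i + 1) y ≤ M * Real.cos (Real.pi / m)) :
    ∃ s t : ℝ, 0 ≤ s ∧ 0 ≤ t ∧ s + t = M ∧
      y = s • dirVec (θ + ang i) + t • dirVec (θ + ang (i + 1)) := by
  have hne := one_ne_zero_zmod hm
  have hne2 := two_ne_zero_zmod hm
  set κ := Real.cos (Real.pi / m) with hκ
  have ha : edgeFun θ i (dirVec (θ + ang i)) = κ := by
    rw [edgeFun_dirVec_zero, sub_self, ang_zero, add_zero]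
  have hb : edgeFun θ i (dirVec (θ + ang (i + 1))) = κ := by
    rw [edgeFun_dirVec_zero, show i - (i + 1) = -1 by ring, cos_pi_div_add_ang_neg_one hm]
  have hc : edgeFun θ (i - 1) (dirVec (θ + ang i)) = κ := by
    rw [edgeFun_dirVec_zero, show i - 1 - i = -1 by ring, cos_pi_div_add_ang_neg_one hm]
  have hd : edgeFun θ (i - 1) (dirVec (θ + ang (i + 1))) < κ := by
    rw [edgeFun_dirVec_zero]
    apply cos_pi_div_add_ang_lt hm
    · rw [show i - 1 - (i + 1) = -2 by ring]; exact neg_ne_zero.2 hne2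
    · intro h
      apply hne
      linear_combination -h
  have he : edgeFun θ (i + 1) (dirVec (θ + ang i)) < κ := by
    rw [edgeFun_dirVec_zero]
    apply cos_pi_div_add_ang_lt hm
    · rw [add_sub_cancel_left]; exact hne
    · intro h
      apply hne2
      linear_combination h
  have hf : edgeFun θ (i + 1) (dirVec (θ + ang (i + 1))) = κ := by
    rw [edgeFun_dirVec_zero, sub_self, ang_zero, add_zero]
  set t := (M * κ - edgeFun θ (i - 1) y) / (κ - edgeFun θ (i - 1) (dirVec (θ + ang (i + 1))))
    with ht
  have ht0 : 0 ≤ t := div_nonneg (by linarith) (by linarith)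
  have htm : t * (κ - edgeFun θ (i - 1) (dirVec (θ + ang (i + 1)))) =
      M * κ - edgeFun θ (i - 1) y := div_mul_cancel₀ _ (by linarith)
  have hy : y = (M - t) • dirVec (θ + ang i) + t • dirVec (θ + ang (i + 1)) := by
    rw [← sub_eq_zero]
    apply eq_zero_of_edgeFun hm (θ := θ) (i := i)
    · simp only [map_sub, map_add, map_smul, smul_eq_mul, h0, ha, hb]; ring
    · simp only [map_sub, map_add, map_smul, smul_eq_mul, hc]; linarith
  refine ⟨M - t, t, ?_, ht0, by ring, hy⟩
  rw [hy] at h2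
  simp only [map_add, map_smul, smul_eq_mul, hf] at h2
  by_contra! h
  nlinarith

/-- Summing over all edges removes every dependence on the centre; the averaging arguments rest on
this. -/
lemma sum_edgeFun (hm : 3 ≤ m) (θ : ℝ) (y : EuclideanSpace ℝ (Fin 2)) :
    ∑ i : ZMod m, edgeFun θ i y = 0 := by
  have h1 := sum_cos_add_ang hm (θ + Real.pi / m)
  have h2 := sum_cos_add_ang hm (θ + Real.pi / m - Real.pi / 2)
  have h3 : ∑ i : ZMod m, Real.sin (θ + Real.pi / m + ang i) = 0 := by
    rw [← h2]
    refine Finset.sum_congr rfl fun i _ => ?_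
    rw [← Real.cos_sub_pi_div_two]
    ring_nf
  simp only [edgeFun, dirFun_apply, Finset.sum_add_distrib, ← Finset.sum_mul, h1, h3]
  ring

lemma sum_dirVec (hm : 3 ≤ m) (θ : ℝ) : ∑ i : ZMod m, dirVec (θ + ang i) = 0 := by
  have h1 := sum_cos_add_ang hm θ
  have h2 := sum_cos_add_ang hm (θ - Real.pi / 2)
  have h3 : ∑ i : ZMod m, Real.sin (θ + ang i) = 0 := by
    rw [← h2]
    refine Finset.sum_congr rfl fun i _ => ?_
    rw [← Real.cos_sub_pi_div_two]
    ring_nf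
  ext j
  fin_cases j
  · simpa [dirVec] using h1
  · simpa [dirVec] using h3

lemma vert_mem_regPoly (hm : 3 ≤ m) (c : EuclideanSpace ℝ (Fin 2)) {ρ : ℝ} (hρ : 0 < ρ) (θ : ℝ)
    (i : ZMod m) : vert c ρ θ i ∈ regPoly m c ρ θ := by
  intro k
  rw [edgeFun_vert, edgeVal]
  have := cos_pi_div_add_ang_le hm (k - i)
  nlinarith

/-- For the hard inclusion, choose the edge whose normal is largest on `x - c`. Then `x - c` lies in
the cone over that edge, at scale `M ≤ ρ`, so `x` is in the triangle spanned by the edge and the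
centre. -/
lemma convexHull_vert (hm : 3 ≤ m) (c : EuclideanSpace ℝ (Fin 2)) {ρ : ℝ} (hρ : 0 < ρ) (θ : ℝ) :
    convexHull ℝ (Set.range (vert (m := m) c ρ θ)) = regPoly m c ρ θ := by
  have hκ := cos_pi_div_pos hm
  apply Set.Subset.antisymm
  · apply convexHull_min _ convex_hpoly
    rintro _ ⟨i, rfl⟩
    exact vert_mem_regPoly hm c hρ θ i
  · intro x hx
    have hC := convex_convexHull ℝ (Set.range (vert (m := m) c ρ θ))
    have hv : ∀ i, vert c ρ θ i ∈ convexHull ℝ (Set.range (vert (m := m) c ρ θ)) :=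
      fun i => subset_convexHull ℝ _ ⟨i, rfl⟩
    have hm0 : (m : ℝ) ≠ 0 := NeZero.ne _
    have hc : c ∈ convexHull ℝ (Set.range (vert (m := m) c ρ θ)) := by
      have h := hC.sum_mem (t := Finset.univ) (w := fun _ : ZMod m => (1 / m : ℝ))
        (z := vert c ρ θ) (fun i _ => by positivity) (by simp [ZMod.card, hm0]) fun i _ => hv i
      rw [← Finset.smul_sum] at h
      simp only [vert, Finset.sum_add_distrib, ← Finset.smul_sum, sum_dirVec hm] at h
      simp only [Finset.sum_const, Finset.card_univ, ZMod.card, smul_zero, add_zero] at h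
      rwa [← Nat.cast_smul_eq_nsmul ℝ, smul_smul, one_div, inv_mul_cancel₀ hm0, one_smul] at h
    obtain ⟨i, hi⟩ := Finite.exists_max fun i : ZMod m => edgeFun θ i (x - c)
    -- The normals sum to zero, so the largest value cannot be negative.
    have h0 : 0 ≤ edgeFun θ i (x - c) := by
      by_contra! h
      have h1 := sum_edgeFun hm θ (x - c)
      have h2 : ∑ j : ZMod m, edgeFun θ j (x - c) < 0 :=
        Finset.sum_neg (fun j _ => (hi j).trans_lt h) Finset.univ_nonempty
      linarith
    set M := edgeFun θ i (x - c) / Real.cos (Real.pi / m) with hM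
    have hMκ : M * Real.cos (Real.pi / m) = edgeFun θ i (x - c) := div_mul_cancel₀ _ hκ.ne'
    obtain ⟨s, t, hs, ht, hst, hy⟩ := exists_edge_coords hm (θ := θ) (i := i) (M := M)
      (y := x - c) hMκ.symm (by rw [hMκ]; exact hi _) (by rw [hMκ]; exact hi _)
    have hMρ : M ≤ ρ := by
      have := hx i
      rw [edgeVal] at this
      rw [map_sub] at hMκ
      by_contra! h
      nlinarith
    have e : x = (s / ρ) • vert c ρ θ i + (t / ρ) • vert c ρ θ (i + 1) + (1 - M / ρ) • c := by
      have e1 : s / ρ * ρ = s := div_mul_cancel₀ _ hρ.ne'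
      have e2 : t / ρ * ρ = t := div_mul_cancel₀ _ hρ.ne'
      have e3 : s / ρ + t / ρ + (1 - M / ρ) = 1 := by rw [← hst]; ring
      have e4 : x = s • dirVec (θ + ang i) + t • dirVec (θ + ang (i + 1)) + c := by
        rw [← hy, sub_add_cancel]
      calc x = (s / ρ * ρ) • dirVec (θ + ang i) + (t / ρ * ρ) • dirVec (θ + ang (i + 1)) +
            (s / ρ + t / ρ + (1 - M / ρ)) • c := by rw [e1, e2, e3, one_smul]; exact e4
        _ = _ := by simp only [vert]; module
    rw [e]
    have hseg := hC.sum_mem (t := Finset.univ) (w := ![s / ρ, t / ρ, 1 - M / ρ])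
      (z := ![vert c ρ θ i, vert c ρ θ (i + 1), c]) ?_ ?_ ?_
    · simpa [Fin.sum_univ_three] using hseg
    · intro j _
      fin_cases j
      · exact div_nonneg hs hρ.le
      · exact div_nonneg ht hρ.le
      · exact sub_nonneg.2 ((div_le_one hρ).2 hMρ)
    · simp only [Fin.sum_univ_three, Matrix.cons_val]
      rw [← hst]; ring
    · intro j _
      fin_cases j
      · exact hv _
      · exact hv _
      · exact hc

lemma isRegularPolygon_iff (hm : 3 ≤ m) (P : Set (EuclideanSpace ℝ (Fin 2))) :
    IsRegularPolygon m P ↔ ∃ c ρ θ, 0 < ρ ∧ P = regPoly m c ρ θ := by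
  have h : ∀ (c : EuclideanSpace ℝ (Fin 2)) (ρ θ : ℝ), (Set.range fun j : Fin m =>
      c + ρ • !₂[Real.cos (θ + 2 * Real.pi * j / m), Real.sin (θ + 2 * Real.pi * j / m)]) =
      Set.range (vert (m := m) c ρ θ) := by
    intro c ρ θ
    ext x
    constructor
    · rintro ⟨j, rfl⟩
      refine ⟨(j : ℕ), ?_⟩
      simp [vert, dirVec, ang, ZMod.val_natCast_of_lt j.2]
    · rintro ⟨i, rfl⟩
      exact ⟨⟨i.val, ZMod.val_lt i⟩, rfl⟩
  constructor
  · rintro ⟨c, ρ, θ, hρ, rfl⟩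
    exact ⟨c, ρ, θ, hρ, by rw [h, convexHull_vert hm c hρ]⟩
  · rintro ⟨c, ρ, θ, hρ, rfl⟩
    exact ⟨c, ρ, θ, hρ, by rw [h, convexHull_vert hm c hρ]⟩

variable {c : EuclideanSpace ℝ (Fin 2)} {ρ θ : ℝ}

lemma exists_of_edge (hm : 3 ≤ m) (hρ : 0 < ρ) {x : EuclideanSpace ℝ (Fin 2)}
    (hx : x ∈ regPoly m c ρ θ) {i : ZMod m} (hi : edgeFun θ i x = edgeVal c ρ θ i) :
    ∃ s t : ℝ, 0 ≤ s ∧ 0 ≤ t ∧ s + t = 1 ∧ x = s • vert c ρ θ i + t • vert c ρ θ (i + 1) := by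
  have h : ∀ j, edgeFun θ j (x - c) ≤ ρ * Real.cos (Real.pi / m) := fun j => by
    have := hx j
    rw [edgeVal] at this
    rw [map_sub]; linarith
  obtain ⟨s, t, hs, ht, hst, hy⟩ := exists_edge_coords hm (θ := θ) (i := i) (M := ρ)
    (y := x - c) (by rw [map_sub, hi, edgeVal]; ring) (h _) (h _)
  refine ⟨s / ρ, t / ρ, div_nonneg hs hρ.le, div_nonneg ht hρ.le, ?_, ?_⟩
  · rw [← add_div, hst, div_self hρ.ne']
  · have e1 : s / ρ * ρ = s := div_mul_cancel₀ _ hρ.ne'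
    have e2 : t / ρ * ρ = t := div_mul_cancel₀ _ hρ.ne'
    have e3 : s / ρ + t / ρ = 1 := by rw [← add_div, hst, div_self hρ.ne']
    calc x = (s / ρ * ρ) • dirVec (θ + ang i) + (t / ρ * ρ) • dirVec (θ + ang (i + 1)) +
            (s / ρ + t / ρ) • c := by rw [e1, e2, e3, one_smul, ← hy, sub_add_cancel]
      _ = _ := by simp only [vert]; module

lemma tight_vert (hm : 3 ≤ m) (hρ : 0 < ρ) (i : ZMod m) :
    tight (edgeFun θ) (edgeVal c ρ θ) (vert c ρ θ i) = {i, i - 1} := by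
  ext k
  rw [tight, Set.mem_ofPred_eq, edgeFun_vert, edgeVal, add_right_inj, mul_right_inj' hρ.ne',
    cos_pi_div_add_ang_eq_iff hm, Set.mem_insert_iff, Set.mem_singleton_iff]
  constructor
  · rintro (h | h)
    · left; linear_combination h
    · right; linear_combination h
  · rintro (rfl | rfl)
    · left; ring
    · right; ring

lemma edgeFun_vert_eq_iff (hm : 3 ≤ m) (hρ : 0 < ρ) (i k : ZMod m) :
    edgeFun θ k (vert c ρ θ i) = edgeVal c ρ θ k ↔ k = i ∨ k = i - 1 := by
  have := congrArg (k ∈ ·) (tight_vert (c := c) (θ := θ) hm hρ i)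
  simpa [tight] using this

/-- Two edges of a regular polygon meet only in a common vertex. -/
lemma eq_vert_of_two_edges (hm : 3 ≤ m) (hρ : 0 < ρ) {x : EuclideanSpace ℝ (Fin 2)}
    (hx : x ∈ regPoly m c ρ θ) {i k : ZMod m} (hik : i ≠ k)
    (hi : edgeFun θ i x = edgeVal c ρ θ i) (hk : edgeFun θ k x = edgeVal c ρ θ k) :
    (k = i - 1 ∧ x = vert c ρ θ i) ∨ (i = k - 1 ∧ x = vert c ρ θ k) := by
  obtain ⟨s, t, hs, ht, hst, rfl⟩ := exists_of_edge hm hρ hx hi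
  rw [map_add, map_smul, map_smul, smul_eq_mul, smul_eq_mul] at hk
  have h1 := vert_mem_regPoly hm c hρ θ i k
  have h2 := vert_mem_regPoly hm c hρ θ (i + 1) k
  have h1' := edgeFun_vert_eq_iff (c := c) (θ := θ) hm hρ i k
  have h2' := edgeFun_vert_eq_iff (c := c) (θ := θ) hm hρ (i + 1) k
  have hs' : s = 1 - t := by linarith
  subst hs'
  rcases hs.eq_or_lt with h | h
  · obtain rfl : t = 1 := by linarith
    rcases h2'.1 (by linarith) with h3 | h3
    · right
      exact ⟨by rw [h3]; ring, by rw [h3]; simp⟩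
    · exact absurd (by rw [h3]; ring) hik
  · have h3 : edgeFun θ k (vert c ρ θ i) = edgeVal c ρ θ k := by nlinarith
    rcases h1'.1 h3 with h4 | h4
    · exact absurd h4.symm hik
    · rcases ht.eq_or_lt with rfl | ht
      · left
        exact ⟨h4, by simp⟩
      · exfalso
        have h5 : edgeFun θ k (vert c ρ θ (i + 1)) = edgeVal c ρ θ k := by nlinarith
        rcases h2'.1 h5 with h6 | h6
        · exact two_ne_zero_zmod hm (by linear_combination h4 - h6)
        · exact one_ne_zero_zmod hm (by linear_combination h4 - h6)

lemma cos_ang_lt (hm : 3 ≤ m) {k : ZMod m} (hk : k ≠ 0) :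
    Real.cos (ang k) < Real.cos (Real.pi / m) := by
  have := cos_add_ang_lt hm (γ := 0) (by simpa using pi_div_pos hm) hk
  simpa using this

/-- The midpoint of an edge of a regular polygon. -/
noncomputable def edgeMid (c : EuclideanSpace ℝ (Fin 2)) (ρ θ : ℝ) (i : ZMod m) :
    EuclideanSpace ℝ (Fin 2) :=
  c + (ρ * Real.cos (Real.pi / m)) • dirVec (θ + Real.pi / m + ang i)

lemma edgeFun_edgeMid (i k : ZMod m) : edgeFun θ k (edgeMid c ρ θ i) =
    edgeFun θ k c + ρ * Real.cos (Real.pi / m) * Real.cos (ang (k - i)) := by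
  rw [edgeMid, map_add, map_smul, edgeFun_dirVec, smul_eq_mul, sub_self, zero_add]

lemma edgeFun_edgeMid_self (i : ZMod m) : edgeFun θ i (edgeMid c ρ θ i) = edgeVal c ρ θ i := by
  rw [edgeFun_edgeMid, edgeVal, sub_self, ang_zero, Real.cos_zero, mul_one]

lemma edgeFun_edgeMid_lt (hm : 3 ≤ m) (hρ : 0 < ρ) {i k : ZMod m} (hik : k ≠ i) :
    edgeFun θ k (edgeMid c ρ θ i) < edgeVal c ρ θ k := by
  rw [edgeFun_edgeMid, edgeVal]
  have h1 := cos_ang_lt hm (sub_ne_zero.2 hik)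
  have h2 := Real.cos_le_one (Real.pi / m)
  have h3 := mul_pos hρ (cos_pi_div_pos hm)
  nlinarith

lemma edgeMid_mem (hm : 3 ≤ m) (hρ : 0 < ρ) (i : ZMod m) :
    edgeMid c ρ θ i ∈ regPoly m c ρ θ := by
  intro k
  by_cases h : k = i
  · rw [h, edgeFun_edgeMid_self]
  · exact (edgeFun_edgeMid_lt hm hρ h).le

lemma tight_edgeMid (hm : 3 ≤ m) (hρ : 0 < ρ) (i : ZMod m) :
    tight (edgeFun θ) (edgeVal c ρ θ) (edgeMid c ρ θ i) = {i} := by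
  ext k
  rw [tight, Set.mem_ofPred_eq, Set.mem_singleton_iff]
  constructor
  · intro h
    by_contra h2
    exact (edgeFun_edgeMid_lt hm hρ h2).ne h
  · rintro rfl
    exact edgeFun_edgeMid_self _

end Polygon

/-! ### Products of polyhedra. -/

section Products

variable {E F : Type*} [AddCommGroup E] [Module ℝ E] [AddCommGroup F] [Module ℝ F] {K L : Type*}

/-- The inequalities of a product of polyhedra. -/
def prodFun (f : K → E →ₗ[ℝ] ℝ) (g : L → F →ₗ[ℝ] ℝ) : K ⊕ L → E × F →ₗ[ℝ] ℝ :=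
  Sum.elim (fun k => f k ∘ₗ LinearMap.fst ℝ E F) fun l => g l ∘ₗ LinearMap.snd ℝ E F

variable {f : K → E →ₗ[ℝ] ℝ} {g : L → F →ₗ[ℝ] ℝ} {b : K → ℝ} {c : L → ℝ}

@[simp] lemma prodFun_inl (k : K) (x : E × F) : prodFun f g (Sum.inl k) x = f k x.1 := rfl

@[simp] lemma prodFun_inr (l : L) (x : E × F) : prodFun f g (Sum.inr l) x = g l x.2 := rfl

lemma hpoly_prodFun : hpoly (prodFun f g) (Sum.elim b c) = hpoly f b ×ˢ hpoly g c := by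
  ext x
  simp [hpoly, Set.mem_prod]

lemma hface_prodFun (S : Set (K ⊕ L)) : hface (prodFun f g) (Sum.elim b c) S =
    hface f b (Sum.inl ⁻¹' S) ×ˢ hface g c (Sum.inr ⁻¹' S) := by
  ext x
  simp only [hface, hpoly_prodFun, Set.mem_prod, Set.mem_ofPred_eq, Sum.forall, Set.mem_preimage,
    prodFun_inl, prodFun_inr, Sum.elim_inl, Sum.elim_inr]
  tauto

lemma hface_prodFun_inl (k : K) : hface (prodFun f g) (Sum.elim b c) {Sum.inl k} =
    hface f b {k} ×ˢ hpoly g c := by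
  rw [hface_prodFun, ← hface_empty (f := g) (b := c)]
  congr 2 <;> ext <;> simp

lemma hface_prodFun_inr (l : L) : hface (prodFun f g) (Sum.elim b c) {Sum.inr l} =
    hpoly f b ×ˢ hface g c {l} := by
  rw [hface_prodFun, ← hface_empty (f := f) (b := b)]
  congr 2 <;> ext <;> simp

lemma tight_prodFun (x : E) (y : F) : tight (prodFun f g) (Sum.elim b c) (x, y) =
    Sum.inl '' tight f b x ∪ Sum.inr '' tight g c y := by
  ext (k | l) <;> simp [tight]

end Products

/-! ### Facets and ridges of a product of two regular polygons. -/

section ProductOfPolygons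

variable {m n : ℕ}

/-- The pairs of facets of the product of an `m`-gon and an `n`-gon that meet in a ridge. -/
def ridgePair : ZMod m ⊕ ZMod n ⊕ ZMod m × ZMod n → Set (ZMod m ⊕ ZMod n)
  | Sum.inl i => {Sum.inl i, Sum.inl (i - 1)}
  | Sum.inr (Sum.inl j) => {Sum.inr j, Sum.inr (j - 1)}
  | Sum.inr (Sum.inr (i, j)) => {Sum.inl i, Sum.inr j}

lemma ridgePair_nonempty (r : ZMod m ⊕ ZMod n ⊕ ZMod m × ZMod n) : (ridgePair r).Nonempty := by
  rcases r with i | j | ⟨i, j⟩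
  exacts [⟨_, Set.mem_insert _ _⟩, ⟨_, Set.mem_insert _ _⟩, ⟨_, Set.mem_insert _ _⟩]

variable {c : EuclideanSpace ℝ (Fin 2)} {ρ θ : ℝ} {c' : EuclideanSpace ℝ (Fin 2)} {ρ' θ' : ℝ}

/-- The inequalities of the product of a regular `m`-gon and a regular `n`-gon. -/
noncomputable abbrev ppFun (m n : ℕ) (θ θ' : ℝ) : ZMod m ⊕ ZMod n →
    EuclideanSpace ℝ (Fin 2) × EuclideanSpace ℝ (Fin 2) →ₗ[ℝ] ℝ :=
  prodFun (edgeFun θ) (edgeFun θ')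

/-- The right-hand sides of the inequalities of the product of two regular polygons. -/
noncomputable abbrev ppVal (m n : ℕ) (c : EuclideanSpace ℝ (Fin 2)) (ρ θ : ℝ)
    (c' : EuclideanSpace ℝ (Fin 2)) (ρ' θ' : ℝ) : ZMod m ⊕ ZMod n → ℝ :=
  Sum.elim (edgeVal c ρ θ) (edgeVal c' ρ' θ')

lemma ppFun_center_lt (hm : 3 ≤ m) (hn : 3 ≤ n) (hρ : 0 < ρ) (hρ' : 0 < ρ') (k : ZMod m ⊕ ZMod n) :
    ppFun m n θ θ' k (c, c') < ppVal m n c ρ θ c' ρ' θ' k := by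
  rcases k with i | j
  · exact edgeFun_center_lt hm hρ i
  · exact edgeFun_center_lt hn hρ' j

lemma tight_center (hm : 3 ≤ m) (hρ : 0 < ρ) :
    tight (edgeFun (m := m) θ) (edgeVal c ρ θ) c = ∅ := by
  ext k
  simp [tight, (edgeFun_center_lt (c := c) (θ := θ) hm hρ k).ne]

lemma center_mem (hm : 3 ≤ m) (hρ : 0 < ρ) : c ∈ regPoly m c ρ θ :=
  fun k => (edgeFun_center_lt hm hρ k).le

variable [NeZero m] [NeZero n]

/-- The midpoint of an edge paired with the centre of the other polygon is a relative interior point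
of the facet. -/
lemma exists_tight_facet (hm : 3 ≤ m) (hn : 3 ≤ n) (hρ : 0 < ρ) (hρ' : 0 < ρ')
    (k : ZMod m ⊕ ZMod n) : ∃ y ∈ hpoly (ppFun m n θ θ') (ppVal m n c ρ θ c' ρ' θ'),
      tight (ppFun m n θ θ') (ppVal m n c ρ θ c' ρ' θ') y = {k} := by
  rcases k with i | j
  · refine ⟨(edgeMid c ρ θ i, c'), ?_, ?_⟩
    · rw [hpoly_prodFun]
      exact ⟨edgeMid_mem hm hρ i, center_mem hn hρ'⟩
    · rw [tight_prodFun, tight_edgeMid hm hρ, tight_center hn hρ']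
      simp
  · refine ⟨(c, edgeMid c' ρ' θ' j), ?_, ?_⟩
    · rw [hpoly_prodFun]
      exact ⟨center_mem hm hρ, edgeMid_mem hn hρ' j⟩
    · rw [tight_prodFun, tight_edgeMid hn hρ', tight_center hm hρ]
      simp

/-- Relative interior points of the three kinds of ridges: vertex × polygon, polygon × vertex and
edge × edge. -/
lemma exists_tight_ridge (hm : 3 ≤ m) (hn : 3 ≤ n) (hρ : 0 < ρ) (hρ' : 0 < ρ')
    (r : ZMod m ⊕ ZMod n ⊕ ZMod m × ZMod n) :
    ∃ y ∈ hpoly (ppFun m n θ θ') (ppVal m n c ρ θ c' ρ' θ'),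
      tight (ppFun m n θ θ') (ppVal m n c ρ θ c' ρ' θ') y = ridgePair r := by
  rcases r with i | j | ⟨i, j⟩
  · refine ⟨(vert c ρ θ i, c'), ?_, ?_⟩
    · rw [hpoly_prodFun]
      exact ⟨vert_mem_regPoly hm c hρ θ i, center_mem hn hρ'⟩
    · rw [tight_prodFun, tight_vert hm hρ, tight_center hn hρ', Set.image_pair]
      simp [ridgePair]
  · refine ⟨(c, vert c' ρ' θ' j), ?_, ?_⟩
    · rw [hpoly_prodFun]
      exact ⟨center_mem hm hρ, vert_mem_regPoly hn c' hρ' θ' j⟩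
    · rw [tight_prodFun, tight_vert hn hρ', tight_center hm hρ, Set.image_pair]
      simp [ridgePair]
  · refine ⟨(edgeMid c ρ θ i, edgeMid c' ρ' θ' j), ?_, ?_⟩
    · rw [hpoly_prodFun]
      exact ⟨edgeMid_mem hm hρ i, edgeMid_mem hn hρ' j⟩
    · rw [tight_prodFun, tight_edgeMid hn hρ', tight_edgeMid hm hρ, Set.image_singleton,
        Set.image_singleton]
      rfl

lemma isRidge_ridgePair (hm : 3 ≤ m) (hn : 3 ≤ n) (hρ : 0 < ρ) (hρ' : 0 < ρ')
    (r : ZMod m ⊕ ZMod n ⊕ ZMod m × ZMod n) :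
    IsRidge (hpoly (ppFun m n θ θ') (ppVal m n c ρ θ c' ρ' θ'))
      (hface (ppFun m n θ θ') (ppVal m n c ρ θ c' ρ' θ') (ridgePair r)) := by
  obtain ⟨z, hz, hzt⟩ := exists_tight_ridge (c := c) (θ := θ) (c' := c') (θ' := θ') hm hn hρ hρ' r
  have hne : ∀ {k : ℕ} (_ : 3 ≤ k) (i : ZMod k), i ≠ i - 1 := fun hk i h =>
    one_ne_zero_zmod hk (by linear_combination h)
  rcases r with i | j | ⟨i, j⟩ <;> dsimp only [ridgePair] at hzt ⊢
  · obtain ⟨y, _, hy⟩ := exists_tight_facet (c := c) (θ := θ) (c' := c') (θ' := θ')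
      hm hn hρ hρ' (Sum.inl i)
    exact isRidge_hface (ppFun_center_lt hm hn hρ hρ') (by simpa using hne hm i) hz hzt hy
  · obtain ⟨y, _, hy⟩ := exists_tight_facet (c := c) (θ := θ) (c' := c') (θ' := θ')
      hm hn hρ hρ' (Sum.inr j)
    exact isRidge_hface (ppFun_center_lt hm hn hρ hρ') (by simpa using hne hn j) hz hzt hy
  · obtain ⟨y, _, hy⟩ := exists_tight_facet (c := c) (θ := θ) (c' := c') (θ' := θ')
      hm hn hρ hρ' (Sum.inl i)
    exact isRidge_hface (ppFun_center_lt hm hn hρ hρ') (by simp) hz hzt hy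

/-- The ridges of a product of two regular polygons. -/
lemma isRidge_iff (hm : 3 ≤ m) (hn : 3 ≤ n) (hρ : 0 < ρ) (hρ' : 0 < ρ')
    (R : Set (EuclideanSpace ℝ (Fin 2) × EuclideanSpace ℝ (Fin 2))) :
    IsRidge (hpoly (ppFun m n θ θ') (ppVal m n c ρ θ c' ρ' θ')) R ↔
      ∃ r, R = hface (ppFun m n θ θ') (ppVal m n c ρ θ c' ρ' θ') (ridgePair r) := by
  constructor
  · intro hR
    obtain ⟨j, k, hjk, rfl, ⟨x, y⟩, hz⟩ := exists_eq_hface_of_isRidge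
      (ppFun_center_lt hm hn hρ hρ') (exists_tight_facet hm hn hρ hρ') hR
    have hzP := hz.1
    rw [hpoly_prodFun] at hzP
    have h1 := hz.2 j (by simp)
    have h2 := hz.2 k (by simp)
    rcases j with i | i <;> rcases k with k | k
    · have h3 : i ≠ k := fun h => hjk (by rw [h])
      rcases eq_vert_of_two_edges hm hρ hzP.1 h3 h1 h2 with h | h
      · exact ⟨Sum.inl i, by rw [h.1]; rfl⟩
      · exact ⟨Sum.inl k, by rw [h.1, Set.pair_comm]; rfl⟩
    · exact ⟨Sum.inr (Sum.inr (i, k)), rfl⟩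
    · exact ⟨Sum.inr (Sum.inr (k, i)), by rw [Set.pair_comm]; rfl⟩
    · have h3 : i ≠ k := fun h => hjk (by rw [h])
      rcases eq_vert_of_two_edges hn hρ' hzP.2 h3 h1 h2 with h | h
      · exact ⟨Sum.inr (Sum.inl i), by rw [h.1]; rfl⟩
      · exact ⟨Sum.inr (Sum.inl k), by rw [h.1, Set.pair_comm]; rfl⟩
  · rintro ⟨r, rfl⟩
    exact isRidge_ridgePair hm hn hρ hρ' r

lemma isFacet_regPoly (hm : 3 ≤ m) (hρ : 0 < ρ) (i : ZMod m) :
    IsFacet (regPoly m c ρ θ) (hface (edgeFun θ) (edgeVal c ρ θ) {i}) :=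
  isFacet_hface (edgeFun_center_lt hm hρ) (edgeMid_mem hm hρ i) (tight_edgeMid hm hρ i)

end ProductOfPolygons

/-- The inequality reads cos(π/n) ≤ sin(π/m) = cos(π/2 - π/m); monotonicity of the cosine turns it
into π/2 ≤ π/m + π/n. -/
lemma cos_sq_add_cos_sq_le_one_iff {m n : ℕ} (hm : 3 ≤ m) (hn : 3 ≤ n) :
    Real.cos (Real.pi / m) ^ 2 + Real.cos (Real.pi / n) ^ 2 ≤ 1 ↔
      m * n ≤ 2 * (m + n) := by
  have hm1 := pi_div_pos hm
  have hm2 := pi_div_le hm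
  have hm3 := cos_pi_div_pos hm
  have hn1 := pi_div_pos hn
  have hn2 := pi_div_le hn
  have hn3 := cos_pi_div_pos hn
  have hpi := Real.pi_pos
  have hs : 0 < Real.sin (Real.pi / m) := Real.sin_pos_of_pos_of_lt_pi hm1 (by linarith)
  have h1 : Real.cos (Real.pi / m) ^ 2 + Real.cos (Real.pi / n) ^ 2 ≤ 1 ↔
      Real.cos (Real.pi / n) ≤ Real.cos (Real.pi / 2 - Real.pi / m) := by
    rw [Real.cos_pi_div_two_sub, ← sq_le_sq₀ hn3.le hs.le]
    have := Real.sin_sq_add_cos_sq (Real.pi / m)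
    constructor <;> intro h <;> linarith
  rw [h1, Real.strictAntiOn_cos.le_iff_ge ⟨hn1.le, by linarith⟩ ⟨by linarith, by linarith⟩]
  have hm0 : (0 : ℝ) < m := by exact_mod_cast (by omega : 0 < m)
  have hn0 : (0 : ℝ) < n := by exact_mod_cast (by omega : 0 < n)
  have h2 : Real.pi / 2 - Real.pi / m ≤ Real.pi / n ↔ (m : ℝ) * n ≤ 2 * (m + n) := by
    have e : Real.pi / n - (Real.pi / 2 - Real.pi / m) =
        Real.pi / (2 * m * n) * (2 * (m + n) - m * n) := by field_simp; ring
    rw [← sub_nonneg, e, mul_nonneg_iff_of_pos_left (by positivity), sub_nonneg]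
  rw [h2]
  exact_mod_cast Iff.rfl

lemma mul_le_two_mul_add_iff {m n : ℕ} (hm : 3 ≤ m) (hn : 3 ≤ n) : m * n ≤ 2 * (m + n) ↔
    ((m, n) ∈ ({(3, 3), (3, 4), (3, 5), (3, 6), (4, 4)} : Set (ℕ × ℕ)) ∨
      (n, m) ∈ ({(3, 3), (3, 4), (3, 5), (3, 6), (4, 4)} : Set (ℕ × ℕ))) := by
  simp only [Set.mem_insert_iff, Set.mem_singleton_iff, Prod.mk.injEq]
  constructor
  · intro h
    -- The condition is (m - 2)(n - 2) ≤ 4 with both factors at least 1.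
    have h1 : m ≤ 6 := by nlinarith
    have h2 : n ≤ 6 := by nlinarith
    interval_cases m <;> interval_cases n <;> simp_all
  · rintro (h | h) <;> rcases h with ⟨rfl, rfl⟩ | ⟨rfl, rfl⟩ | ⟨rfl, rfl⟩ | ⟨rfl, rfl⟩ | ⟨rfl, rfl⟩ <;>
      norm_num

/-! ### Necessity: supporting hyperplanes at the ridges. -/

section Forward

variable {E : Type*} [AddCommGroup E] [Module ℝ E]

/-- The zero functional would cut out all of `Q`, which is not of codimension one in itself. -/
lemma exists_cutsOut_ne_zero {Q G : Set E} (hG : IsFacet Q G) :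
    ∃ (l : E →ₗ[ℝ] ℝ) (a : ℝ), CutsOut Q G l a ∧ l ≠ 0 := by
  obtain ⟨⟨z, hz⟩, ⟨l, a, hl⟩, hd⟩ := hG
  refine ⟨l, a, hl, ?_⟩
  rintro rfl
  have hz2 := hz
  rw [hl.2] at hz2
  have : G = Q := by
    rw [hl.2]
    ext y
    exact ⟨fun h => h.1, fun h => ⟨h, hz2.2⟩⟩
  rw [this] at hd
  omega

lemma subset_of_isVertexPreservingE {P Q : Set E} {v : Set E → E}
    (h : IsVertexPreservingE P v Q) : P ⊆ Q := by
  rw [h.2.1]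
  exact Set.subset_union_left.trans (subset_convexHull ℝ _)

lemma new_vertex_mem {P Q F : Set E} {v : Set E → E}
    (h : IsVertexPreservingE P v Q) (hF : IsFacet P F) : v F ∈ Q := by
  rw [h.2.1]
  exact subset_convexHull ℝ _ (Or.inr ⟨F, hF, rfl⟩)

/-- Every ridge of `P` lies, with its new vertices, in a supporting hyperplane of `Q`. -/
lemma exists_support_of_isRidge {P Q R : Set E} {v : Set E → E}
    (h : IsVertexPreservingE P v Q) (hR : IsRidge P R) :
    ∃ (l : E →ₗ[ℝ] ℝ) (a : ℝ), l ≠ 0 ∧ (∀ y ∈ Q, l y ≤ a) ∧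
      ∀ F, IsFacet P F → R ⊆ F → l (v F) = a ∧ ∀ x ∈ R, l x = a := by
  obtain ⟨l, a, hl, hne⟩ := exists_cutsOut_ne_zero ((h.2.2 _).2 ⟨R, hR, rfl⟩)
  refine ⟨l, a, hne, hl.1, fun F hF hRF => ?_⟩
  have hsub : insert (v F) R ⊆ mergedFacet P v R :=
    (subset_convexHull ℝ _).trans (Set.subset_biUnion_of_mem
      (u := fun F => convexHull ℝ (insert (v F) R)) (show F ∈ {F | IsFacet P F ∧ R ⊆ F} from
        ⟨hF, hRF⟩))
  rw [hl.2] at hsub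
  exact ⟨(hsub (Set.mem_insert _ _)).2, fun x hx => (hsub (Set.mem_insert_of_mem _ hx)).2⟩

/-- A functional that is constant on a slice `{w} × P` with `P` full-dimensional does not depend
on the second factor. -/
lemma exists_fst_of_const {F : Type*} [AddCommGroup F] [Module ℝ F] {l : E × F →ₗ[ℝ] ℝ} {a : ℝ}
    {P : Set F} (hP : vectorSpan ℝ P = ⊤) {w : E} (h : ∀ y ∈ P, l (w, y) = a) :
    ∀ x y, l (x, y) = l (x, 0) := by
  have h0 : ∀ d : F, l (0, d) = 0 := by
    intro d
    have hd : d ∈ vectorSpan ℝ P := by rw [hP]; trivial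
    have hle : vectorSpan ℝ P ≤ LinearMap.ker (l ∘ₗ LinearMap.inr ℝ E F) := by
      rw [vectorSpan, Submodule.span_le]
      rintro _ ⟨y, hy, y', hy', rfl⟩
      have : ((0 : E), y - y') = (w, y) - (w, y') := by simp
      change l (0, y - y') = 0
      rw [this, map_sub, h y hy, h y' hy', sub_self]
    exact hle hd
  intro x y
  have : (x, y) = (x, (0 : F)) + ((0 : E), y) := by simp
  rw [this, map_add, h0, add_zero]

lemma exists_snd_of_const {F : Type*} [AddCommGroup F] [Module ℝ F] {l : E × F →ₗ[ℝ] ℝ} {a : ℝ}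
    {P : Set E} (hP : vectorSpan ℝ P = ⊤) {w : F} (h : ∀ x ∈ P, l (x, w) = a) :
    ∀ x y, l (x, y) = l (0, y) := by
  have := exists_fst_of_const (l := l ∘ₗ (LinearEquiv.prodComm ℝ F E).toLinearMap) hP
    (w := w) (a := a) (fun y hy => h y hy)
  exact fun x y => this y x

end Forward

/-! ### Necessity: intersection ratios as linear equations. -/

section Fractions

variable {K : Type*} {f : K → EuclideanSpace ℝ (Fin 2) →ₗ[ℝ] ℝ} {b : K → ℝ}

lemma isClosed_hpoly : IsClosed (hpoly f b) := by
  have : hpoly f b = ⋂ k, {x | f k x ≤ b k} := by ext; simp [hpoly]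
  rw [this]
  exact isClosed_iInter fun k =>
    isClosed_le (f k).continuous_of_finiteDimensional continuous_const

lemma exists_tight_of_mem_frontier [Finite K] {q : EuclideanSpace ℝ (Fin 2)} (hq : q ∈ frontier (hpoly f b)) :
    ∃ k, f k q = b k := by
  by_contra! h
  have hmem := isClosed_hpoly.frontier_subset hq
  apply hq.2
  rw [mem_interior]
  refine ⟨⋂ k, {x | f k x < b k}, ?_, ?_, ?_⟩
  · intro x hx k
    exact (Set.mem_iInter.1 hx k).le
  · exact isOpen_iInter_of_finite fun k =>
      isOpen_lt (f k).continuous_of_finiteDimensional continuous_const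
  · exact Set.mem_iInter.2 fun k => lt_of_le_of_ne (hmem k) (h k)

lemma convex_comb_lt {x y t a : ℝ} (ht : 0 ≤ t) (ht' : t ≤ 1) (hx : x < a) (hy : y < a) :
    (1 - t) * x + t * y < a := by
  rcases ht.eq_or_lt with rfl | ht
  · linarith
  · nlinarith [mul_pos ht (sub_pos.2 hy)]

/-- The boundary point on the segment must be tight for some inequality; those other than `i` are
strict at both ends, so it lies on edge `i`. The metric condition thus becomes a linear equation for
`r`. -/
lemma outsideFraction_eq [Finite K] {x y : EuclideanSpace ℝ (Fin 2)} {r : ℝ}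
    (h : HasOutsideFraction (hpoly f b) x y r) {i : K} (hx : b i < f i x)
    (hx' : ∀ k, k ≠ i → f k x < b k) (hy : ∀ k, f k y < b k) :
    0 ≤ r ∧ (1 - r) * f i x + r * f i y = b i := by
  obtain ⟨q, ⟨s, t, hs, ht, hst, hq⟩, hqf, hd⟩ := h
  have hxy : x ≠ y := by rintro rfl; exact lt_asymm hx (hy i)
  rw [dist_eq_of_affine ht hst hq] at hd
  obtain rfl := mul_right_cancel₀ (dist_ne_zero.2 hxy) hd
  refine ⟨ht, ?_⟩
  obtain ⟨k, hk⟩ := exists_tight_of_mem_frontier hqf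
  obtain rfl : s = 1 - t := by linarith
  rw [← hq, map_add, map_smul, map_smul, smul_eq_mul, smul_eq_mul] at hk
  by_cases hki : k = i
  · rwa [hki] at hk
  · exact absurd hk (convex_comb_lt ht (by linarith) (hx' k hki) (hy k)).ne

/-- Past its crossing with edge `i` the segment stays strictly inside the polygon. -/
lemma lt_of_beyond_crossing {x y : EuclideanSpace ℝ (Fin 2)} {r t : ℝ} {i : K} (hx : b i < f i x)
    (hx' : ∀ k, k ≠ i → f k x < b k) (hy : ∀ k, f k y < b k) (hr : 0 ≤ r)
    (hrb : (1 - r) * f i x + r * f i y = b i) (hrt : r < t) (ht : t ≤ 1) (k : K) :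
    f k ((1 - t) • x + t • y) < b k := by
  rw [map_add, map_smul, map_smul, smul_eq_mul, smul_eq_mul]
  by_cases hki : k = i
  · subst hki
    have := hy k
    nlinarith
  · exact convex_comb_lt (by linarith) ht (hx' k hki) (hy k)

end Fractions

/-! ### Necessity: the bound κ² ≤ 1 - r in one factor. -/

section Planar

lemma eq_smul_dirVec_of_dirFun_eq_zero {α : ℝ} {x : EuclideanSpace ℝ (Fin 2)}
    (h : dirFun α x = 0) : ∃ t : ℝ, x = t • dirVec (α + Real.pi / 2) := by
  refine ⟨dirFun (α + Real.pi / 2) x, ?_⟩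
  rw [dirFun_apply] at h
  have hs := Real.sin_sq_add_cos_sq α
  ext j
  fin_cases j
  · simp [dirFun_apply, dirVec, Real.cos_add_pi_div_two, Real.sin_add_pi_div_two]
    linear_combination Real.cos α * h - x 0 * hs
  · simp [dirFun_apply, dirVec, Real.cos_add_pi_div_two, Real.sin_add_pi_div_two]
    linear_combination Real.sin α * h - x 1 * hs

variable {m : ℕ} [NeZero m] {c : EuclideanSpace ℝ (Fin 2)} {ρ θ : ℝ}

lemma dirFun_le_of_mem_regPoly (hm : 3 ≤ m) (hρ : 0 < ρ) {x : EuclideanSpace ℝ (Fin 2)}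
    (hx : x ∈ regPoly m c ρ θ) (α : ℝ) : dirFun α x ≤ dirFun α c + ρ := by
  rw [← convexHull_vert hm c hρ] at hx
  have : convexHull ℝ (Set.range (vert (m := m) c ρ θ)) ⊆ {y | dirFun α y ≤ dirFun α c + ρ} := by
    apply convexHull_min _ (convex_halfSpace_le (dirFun α).isLinear _)
    rintro _ ⟨i, rfl⟩
    rw [Set.mem_ofPred_eq, vert, map_add, map_smul, dirFun_dirVec, smul_eq_mul]
    have := Real.cos_le_one (α - (θ + ang i))
    nlinarith
  exact this hx

lemma sum_edgeVal (hm : 3 ≤ m) :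
    ∑ i : ZMod m, edgeVal c ρ θ i = m * (ρ * Real.cos (Real.pi / m)) := by
  simp [edgeVal, Finset.sum_add_distrib, sum_edgeFun hm, ZMod.card]

/-- A regular polygon `U` that is circumscribed about a regular polygon in such a way that every
edge of `U` carries a vertex of the inscribed polygon has inradius at most the circumradius of
the inscribed polygon. -/
lemma inradius_le_circumradius (hm : 3 ≤ m) (hρ : 0 < ρ)
    {c' : EuclideanSpace ℝ (Fin 2)} {R θ' : ℝ} {σ : ZMod m → ZMod m}
    (hσ : Function.Injective σ)
    (hv : ∀ i, edgeFun θ' (σ i) (vert c ρ θ i) = edgeVal c' R θ' (σ i)) :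
    R * Real.cos (Real.pi / m) ≤ ρ := by
  have hm0 : (0 : ℝ) < m := by exact_mod_cast NeZero.pos m
  have hbij := Finite.injective_iff_bijective.1 hσ
  have hsum : ∀ y, ∑ i : ZMod m, edgeFun θ' (σ i) y = 0 := fun y => by
    rw [← sum_edgeFun hm θ' y]
    exact (Equiv.ofBijective σ hbij).sum_comp fun k => edgeFun θ' k y
  have h1 : ∑ i : ZMod m, edgeFun θ' (σ i) (vert c ρ θ i) =
      m * (R * Real.cos (Real.pi / m)) := by
    rw [Finset.sum_congr rfl fun i _ => hv i]
    simp only [edgeVal, Finset.sum_add_distrib, hsum, zero_add, Finset.sum_const,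
      Finset.card_univ, ZMod.card, nsmul_eq_mul]
  -- Each vertex of the inscribed polygon is at distance ρ from `c`, so no unit normal exceeds its
  -- value at `c` by more than ρ there.
  have h2 : ∑ i : ZMod m, edgeFun θ' (σ i) (vert c ρ θ i) ≤
      ∑ i : ZMod m, (edgeFun θ' (σ i) c + ρ) :=
    Finset.sum_le_sum fun i _ =>
      dirFun_le_of_mem_regPoly hm hρ (vert_mem_regPoly hm c hρ θ i) _
  rw [Finset.sum_add_distrib, hsum, zero_add, Finset.sum_const, Finset.card_univ, ZMod.card,
    nsmul_eq_mul, h1] at h2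
  exact le_of_mul_le_mul_left h2 hm0

/-- The bound on the intersection ratio in one factor. -/
lemma cos_sq_le_of_ratio (hm : 3 ≤ m) (hρ : 0 < ρ) {U : Set (EuclideanSpace ℝ (Fin 2))}
    (hU : IsRegularPolygon m U) {u : ZMod m → EuclideanSpace ℝ (Fin 2)}
    {p : EuclideanSpace ℝ (Fin 2)} {r : ℝ} (hu : ∀ i, u i ∈ U) (hw : ∀ i : ZMod m, vert c ρ θ i ∈ U)
    (hbeyond : ∀ i, edgeVal c ρ θ i < edgeFun θ i (u i))
    (hother : ∀ i k, k ≠ i → edgeFun θ k (u i) < edgeVal c ρ θ k)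
    (hsupp : ∀ i, ∃ (l : EuclideanSpace ℝ (Fin 2) →ₗ[ℝ] ℝ) (a : ℝ), l ≠ 0 ∧
      (∀ y ∈ U, l y ≤ a) ∧ l (vert c ρ θ i) = a ∧ l (u i) = a)
    (hr : ∀ i, (1 - r) * edgeFun θ i (u i) + r * edgeFun θ i p = edgeVal c ρ θ i) :
    Real.cos (Real.pi / m) ^ 2 ≤ 1 - r := by
  obtain ⟨c', R, θ', hR, rfl⟩ := (isRegularPolygon_iff hm U).1 hU
  have hκ := cos_pi_div_pos hm
  have hm0 : (0 : ℝ) < m := by exact_mod_cast NeZero.pos m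
  -- The supporting line through `vert i` and `u i` meets `U` in a proper face; at a generic point
  -- of that face some edge inequality of `U` is tight, and then it is tight on the whole face.
  have hedge : ∀ i, ∃ k : ZMod m, edgeFun θ' k (vert c ρ θ i) = edgeVal c' R θ' k ∧
      edgeFun θ' k (u i) = edgeVal c' R θ' k := by
    intro i
    obtain ⟨l, a, hl, hmax, h1, h2⟩ := hsupp i
    have hcut : CutsOut (regPoly m c' R θ') {y | y ∈ regPoly m c' R θ' ∧ l y = a} l a :=
      ⟨hmax, rfl⟩
    have hv' : vert c ρ θ i ∈ {y | y ∈ regPoly m c' R θ' ∧ l y = a} := ⟨hw i, h1⟩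
    have hu' : u i ∈ {y | y ∈ regPoly m c' R θ' ∧ l y = a} := ⟨hu i, h2⟩
    obtain ⟨z, hz, hF⟩ := exists_tight_of_cutsOut hcut ⟨_, hv'⟩
    have hne : ∃ k : ZMod m, edgeFun θ' k z = edgeVal c' R θ' k := by
      by_contra! h
      exact hl (functional_eq_zero_of_max hmax (fun k => lt_of_le_of_ne (hz.1 k) (h k)) hz.2)
    obtain ⟨k, hk⟩ := hne
    rw [hF] at hv' hu'
    exact ⟨k, hv'.2 k hk, hu'.2 k hk⟩
  choose σ hσv hσu using hedge
  -- If `σ i = σ j`, then `vert i`, `vert j` and `u i` are collinear. Since `u i` is beyond edge `i`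
  -- but strictly inside edge `i - 1`, the functionals of these two edges change with opposite signs
  -- along the line. Moving from `vert i`, where both are tight, in either direction leaves the
  -- inscribed polygon, so `vert j = vert i`.
  have hinj : Function.Injective σ := by
    intro i j hij
    have hd := eq_smul_dirVec_of_dirFun_eq_zero (α := θ' + Real.pi / m + ang (σ i))
      (x := vert c ρ θ j - vert c ρ θ i) (by
        change edgeFun θ' (σ i) _ = 0
        rw [map_sub, hσv i, hij, hσv j, sub_self])
    have ha := eq_smul_dirVec_of_dirFun_eq_zero (α := θ' + Real.pi / m + ang (σ i))
      (x := u i - vert c ρ θ i) (by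
        change edgeFun θ' (σ i) _ = 0
        rw [map_sub, hσv i, hσu i, sub_self])
    obtain ⟨δ, hd⟩ := hd
    obtain ⟨A, ha⟩ := ha
    set e := dirVec (θ' + Real.pi / m + ang (σ i) + Real.pi / 2)
    have hi : edgeFun θ i (vert c ρ θ i) = edgeVal c ρ θ i :=
      (edgeFun_vert_eq_iff hm hρ i i).2 (Or.inl rfl)
    have hi' : edgeFun θ (i - 1) (vert c ρ θ i) = edgeVal c ρ θ (i - 1) :=
      (edgeFun_vert_eq_iff hm hρ i (i - 1)).2 (Or.inr rfl)
    have hne : i - 1 ≠ i := fun h => one_ne_zero_zmod hm (by linear_combination -h)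
    have e1 := congrArg (edgeFun θ i) ha
    have e2 := congrArg (edgeFun θ (i - 1)) ha
    have e3 := congrArg (edgeFun θ i) hd
    have e4 := congrArg (edgeFun θ (i - 1)) hd
    simp only [map_sub, map_smul, smul_eq_mul, hi, hi'] at e1 e2 e3 e4
    have b1 := hbeyond i
    have b2 := hother i (i - 1) hne
    have b3 := vert_mem_regPoly hm c hρ θ j i
    have b4 := vert_mem_regPoly hm c hρ θ j (i - 1)
    have f1 : 0 < A * edgeFun θ i e := by linarith
    have f2 : A * edgeFun θ (i - 1) e < 0 := by linarith
    have f3 : δ * edgeFun θ i e ≤ 0 := by linarith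
    have f4 : δ * edgeFun θ (i - 1) e ≤ 0 := by linarith
    have hA : A ≠ 0 := by rintro rfl; simp at f1
    have hδ : δ = 0 := by
      have g1 : A * δ * edgeFun θ i e ^ 2 ≤ 0 := by nlinarith
      have g2 : 0 ≤ A * δ * edgeFun θ (i - 1) e ^ 2 := by nlinarith
      have n1 : edgeFun θ i e ≠ 0 := by intro h; rw [h] at f1; simp at f1
      have n2 : edgeFun θ (i - 1) e ≠ 0 := by intro h; rw [h] at f2; simp at f2
      have g3 : A * δ ≤ 0 := by
        by_contra! h
        have := mul_pos h (pow_pos (abs_pos.2 n1) 2)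
        rw [sq_abs] at this
        linarith
      have g4 : 0 ≤ A * δ := by
        by_contra! h
        have := mul_neg_of_neg_of_pos h (pow_pos (abs_pos.2 n2) 2)
        rw [sq_abs] at this
        linarith
      simpa [hA] using le_antisymm g3 g4
    rw [hδ, zero_smul, sub_eq_zero] at hd
    rw [← hd] at hi hi'
    rcases (edgeFun_vert_eq_iff hm hρ j i).1 hi with h | h
    · exact h
    · rcases (edgeFun_vert_eq_iff hm hρ j (i - 1)).1 hi' with h' | h'
      · exact absurd (by linear_combination h - h') (two_ne_zero_zmod hm)
      · linear_combination h'
  have hRρ := inradius_le_circumradius hm hρ hinj hσv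
  -- Summed over all edges, the term at `p` vanishes and the ratio equations become (1 - r) A = m ρ
  -- κ, where A ≤ m R.
  have hsum := Finset.sum_congr (s₁ := Finset.univ) rfl fun i _ => hr i
  rw [Finset.sum_add_distrib, ← Finset.mul_sum, ← Finset.mul_sum, sum_edgeFun hm, mul_zero,
    add_zero, sum_edgeVal hm] at hsum
  set A := ∑ i : ZMod m, edgeFun θ i (u i) with hA
  have hAR : A ≤ m * R := by
    have : A ≤ ∑ i : ZMod m, (edgeFun θ i c' + R) :=
      Finset.sum_le_sum fun i _ => dirFun_le_of_mem_regPoly hm hR (hu i) _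
    simpa [Finset.sum_add_distrib, sum_edgeFun hm, ZMod.card] using this
  have hA0 : 0 < A := by
    have : ∑ i : ZMod m, edgeVal c ρ θ i < A :=
      Finset.sum_lt_sum_of_nonempty Finset.univ_nonempty fun i _ => hbeyond i
    rw [sum_edgeVal hm] at this
    have h3 := mul_pos hm0 (mul_pos hρ hκ)
    linarith
  have hr0 : 0 ≤ 1 - r := by
    by_contra! h
    have h3 := mul_pos hm0 (mul_pos hρ hκ)
    have h4 := mul_neg_of_neg_of_pos h hA0
    linarith
  have h4 : m * R * Real.cos (Real.pi / m) ^ 2 ≤ m * R * (1 - r) := by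
    calc m * R * Real.cos (Real.pi / m) ^ 2
        = m * ((R * Real.cos (Real.pi / m)) * Real.cos (Real.pi / m)) := by ring
      _ ≤ m * (ρ * Real.cos (Real.pi / m)) := by gcongr
      _ = (1 - r) * A := hsum.symm
      _ ≤ (1 - r) * (m * R) := by gcongr
      _ = m * R * (1 - r) := by ring
  exact le_of_mul_le_mul_left h4 (mul_pos hm0 hR)

end Planar

/-- The necessary condition for a realisation from regular polygons. -/
theorem cos_sq_add_cos_sq_le_one_of_isRegularRealisation {m n : ℕ} (hm : 3 ≤ m) (hn : 3 ≤ n)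
    {Q : Set (EuclideanSpace ℝ (Fin 2) × EuclideanSpace ℝ (Fin 2))}
    (hQ : IsRegularRealisation m n Q) :
    Real.cos (Real.pi / m) ^ 2 + Real.cos (Real.pi / n) ^ 2 ≤ 1 := by
  have : NeZero m := ⟨by omega⟩
  have : NeZero n := ⟨by omega⟩
  obtain ⟨P₀, P₁, v, hE, hP₀, hP₁, hU, hW, ⟨r₀, h₀⟩, r₁, h₁⟩ := hQ
  obtain ⟨c, ρ, θ, hρ, rfl⟩ := (isRegularPolygon_iff hm P₀).1 hP₀
  obtain ⟨c', ρ', θ', hρ', rfl⟩ := (isRegularPolygon_iff hn P₁).1 hP₁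
  have hprod : regPoly m c ρ θ ×ˢ regPoly n c' ρ' θ' =
      hpoly (ppFun m n θ θ') (ppVal m n c ρ θ c' ρ' θ') := hpoly_prodFun.symm
  rw [hprod] at hE
  have hcen := ppFun_center_lt (c := c) (θ := θ) (c' := c') (θ' := θ') hm hn hρ hρ'
  have hfac := exists_tight_facet (c := c) (θ := θ) (c' := c') (θ' := θ') hm hn hρ hρ'
  have hfacet : ∀ k, IsFacet (hpoly (ppFun m n θ θ') (ppVal m n c ρ θ c' ρ' θ'))
      (hface (ppFun m n θ θ') (ppVal m n c ρ θ c' ρ' θ') {k}) := fun k => by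
    obtain ⟨y, hy, hyk⟩ := hfac k
    exact isFacet_hface hcen hy hyk
  set w : ZMod m ⊕ ZMod n → EuclideanSpace ℝ (Fin 2) × EuclideanSpace ℝ (Fin 2) :=
    fun k => v (hface (ppFun m n θ θ') (ppVal m n c ρ θ c' ρ' θ') {k}) with hw
  have hwQ : ∀ k, w k ∈ Q := fun k => new_vertex_mem hE (hfacet k)
  have hPQ := subset_of_isVertexPreservingE hE
  have hbey : ∀ k, ppVal m n c ρ θ c' ρ' θ' k < ppFun m n θ θ' k (w k) ∧
      ∀ j, j ≠ k → ppFun m n θ θ' j (w k) < ppVal m n c ρ θ c' ρ' θ' j := fun k =>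
    (isBeyond_hface_iff hcen hfac k _).1 (hE.1 _ (hfacet k))
  have hsupp : ∀ r : ZMod m ⊕ ZMod n ⊕ ZMod m × ZMod n, ∃ (l : _ →ₗ[ℝ] ℝ) (a : ℝ), l ≠ 0 ∧
      (∀ y ∈ Q, l y ≤ a) ∧ (∀ k ∈ ridgePair r, l (w k) = a) ∧
      ∀ x ∈ hface (ppFun m n θ θ') (ppVal m n c ρ θ c' ρ' θ') (ridgePair r), l x = a := by
    intro r
    obtain ⟨l, a, hl, hmax, h⟩ := exists_support_of_isRidge hE
      (isRidge_ridgePair hm hn hρ hρ' r)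
    have hsub : ∀ k ∈ ridgePair r, hface (ppFun m n θ θ') (ppVal m n c ρ θ c' ρ' θ') (ridgePair r) ⊆
        hface (ppFun m n θ θ') (ppVal m n c ρ θ c' ρ' θ') {k} := by
      intro k hk x hx
      refine ⟨hx.1, ?_⟩
      rintro _ rfl
      exact hx.2 _ hk
    obtain ⟨k, hk⟩ := ridgePair_nonempty r
    exact ⟨l, a, hl, hmax, fun k hk => (h _ (hfacet k) (hsub k hk)).1,
      (h _ (hfacet k) (hsub k hk)).2⟩
  have hF₀ : ∀ i : ZMod m, v (hface (edgeFun θ) (edgeVal c ρ θ) {i} ×ˢ regPoly n c' ρ' θ') =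
      w (Sum.inl i) := fun i => by rw [hw]; simp only; rw [hface_prodFun_inl]; rfl
  have hF₁ : ∀ j : ZMod n, v (regPoly m c ρ θ ×ˢ hface (edgeFun θ') (edgeVal c' ρ' θ') {j}) =
      w (Sum.inr j) := fun j => by rw [hw]; simp only; rw [hface_prodFun_inr]; rfl
  have hr₀ : ∀ i j, 0 ≤ r₀ ∧ (1 - r₀) * edgeFun θ i (w (Sum.inl i)).1 +
      r₀ * edgeFun θ i (w (Sum.inr j)).1 = edgeVal c ρ θ i := by
    intro i j
    have := h₀ _ _ (isFacet_regPoly hm hρ i) (isFacet_regPoly hn hρ' j)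
    rw [hF₀, hF₁] at this
    exact outsideFraction_eq this (hbey (Sum.inl i)).1
      (fun k hk => (hbey (Sum.inl i)).2 (Sum.inl k) (by simpa using hk))
      fun k => (hbey (Sum.inr j)).2 (Sum.inl k) (by simp)
  have hr₁ : ∀ i j, 0 ≤ r₁ ∧ (1 - r₁) * edgeFun θ' j (w (Sum.inr j)).2 +
      r₁ * edgeFun θ' j (w (Sum.inl i)).2 = edgeVal c' ρ' θ' j := by
    intro i j
    have := h₁ _ _ (isFacet_regPoly hm hρ i) (isFacet_regPoly hn hρ' j)
    rw [hF₀, hF₁] at this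
    exact outsideFraction_eq this (hbey (Sum.inr j)).1
      (fun k hk => (hbey (Sum.inr j)).2 (Sum.inr k) (by simpa using hk))
      fun k => (hbey (Sum.inl i)).2 (Sum.inr k) (by simp)
  have hsum : 1 ≤ r₀ + r₁ := by
    by_contra! hlt
    have p₀ := (hr₀ 0 0).1
    have p₁ := (hr₁ 0 0).1
    obtain ⟨l, a, hl, hmax, hk, -⟩ := hsupp (Sum.inr (Sum.inr (0, 0)))
    have k₀ := hk (Sum.inl 0) (by simp [ridgePair])
    have k₁ := hk (Sum.inr 0) (by simp [ridgePair])
    -- If r₀ + r₁ < 1, this lies strictly between r₀ and 1 - r₁, so the point of the segment at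
    -- parameter `t` is interior to both factors. The functional supporting `Q` at the ridge F₀ × F₁
    -- attains its maximum there.
    set t := (r₀ + (1 - r₁)) / 2 with ht
    refine hl (functional_eq_zero_of_max (f := ppFun m n θ θ') (b := ppVal m n c ρ θ c' ρ' θ')
      (z := (1 - t) • w (Sum.inl 0) + t • w (Sum.inr 0)) (fun y hy => hmax y (hPQ hy)) ?_ ?_)
    · rintro (k | k)
      · have := lt_of_beyond_crossing (f := edgeFun θ) (b := edgeVal c ρ θ) (i := (0 : ZMod m))
          (hbey (Sum.inl 0)).1
          (fun k hk => (hbey (Sum.inl 0)).2 (Sum.inl k) (by simpa using hk))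
          (fun k => (hbey (Sum.inr 0)).2 (Sum.inl k) (by simp)) p₀ (hr₀ 0 0).2
          (t := t) (by linarith) (by linarith) k
        exact this
      · have := lt_of_beyond_crossing (f := edgeFun θ') (b := edgeVal c' ρ' θ') (i := (0 : ZMod n))
          (hbey (Sum.inr 0)).1
          (fun k hk => (hbey (Sum.inr 0)).2 (Sum.inr k) (by simpa using hk))
          (fun k => (hbey (Sum.inl 0)).2 (Sum.inr k) (by simp)) p₁ (hr₁ 0 0).2
          (t := 1 - t) (by linarith) (by linarith) k
        rw [sub_sub_cancel, add_comm] at this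
        exact this
    · rw [map_add, map_smul, map_smul, k₀, k₁, smul_eq_mul, smul_eq_mul]
      ring
  have hspan₁ : vectorSpan ℝ (regPoly n c' ρ' θ') = ⊤ :=
    vectorSpan_hpoly (edgeFun_center_lt hn hρ')
  have hspan₀ : vectorSpan ℝ (regPoly m c ρ θ) = ⊤ :=
    vectorSpan_hpoly (edgeFun_center_lt hm hρ)
  have b₀ : Real.cos (Real.pi / m) ^ 2 ≤ 1 - r₀ := by
    refine cos_sq_le_of_ratio (c := c) (θ := θ) hm hρ hU (u := fun i => (w (Sum.inl i)).1)
      (p := (w (Sum.inr 0)).1) (fun i => ⟨_, hwQ _, rfl⟩)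
      (fun i => ⟨(vert c ρ θ i, c'), hPQ ?_, rfl⟩) (fun i => (hbey (Sum.inl i)).1)
      (fun i k hk => (hbey (Sum.inl i)).2 (Sum.inl k) (by simpa using hk)) (fun i => ?_)
      fun i => (hr₀ i 0).2
    · rw [← hprod]
      exact ⟨vert_mem_regPoly hm c hρ θ i, center_mem hn hρ'⟩
    · obtain ⟨l, a, hl, hmax, hk, hR⟩ := hsupp (Sum.inl i)
      -- The supporting functional is constant on vertex × P₁ and P₁ is full-dimensional, so it
      -- descends to the first factor and supports the projection of `Q`.
      have hslice : ∀ y ∈ regPoly n c' ρ' θ', l (vert c ρ θ i, y) = a := by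
        intro y hy
        apply hR
        refine ⟨?_, ?_⟩
        · rw [← hprod]; exact ⟨vert_mem_regPoly hm c hρ θ i, hy⟩
        · rintro _ (rfl | rfl)
          · exact (edgeFun_vert_eq_iff hm hρ i i).2 (Or.inl rfl)
          · exact (edgeFun_vert_eq_iff hm hρ i _).2 (Or.inr rfl)
      have hfst := exists_fst_of_const hspan₁ hslice
      refine ⟨l ∘ₗ LinearMap.inl ℝ _ _, a, ?_, ?_, ?_, ?_⟩
      · intro h
        apply hl
        apply LinearMap.ext
        rintro ⟨x, y⟩
        rw [hfst]
        exact LinearMap.congr_fun h x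
      · rintro _ ⟨⟨x, y⟩, hy, rfl⟩
        have := hmax _ hy
        rwa [hfst] at this
      · rw [LinearMap.comp_apply, LinearMap.inl_apply, ← hfst _ c']
        exact hslice _ (center_mem hn hρ')
      · rw [LinearMap.comp_apply, LinearMap.inl_apply, ← hfst _ (w (Sum.inl i)).2]
        exact hk _ (by simp [ridgePair])
  have b₁ : Real.cos (Real.pi / n) ^ 2 ≤ 1 - r₁ := by
    refine cos_sq_le_of_ratio (c := c') (θ := θ') hn hρ' hW (u := fun j => (w (Sum.inr j)).2)
      (p := (w (Sum.inl 0)).2) (fun j => ⟨_, hwQ _, rfl⟩)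
      (fun j => ⟨(c, vert c' ρ' θ' j), hPQ ?_, rfl⟩) (fun j => (hbey (Sum.inr j)).1)
      (fun j k hk => (hbey (Sum.inr j)).2 (Sum.inr k) (by simpa using hk)) (fun j => ?_)
      fun j => (hr₁ 0 j).2
    · rw [← hprod]
      exact ⟨center_mem hm hρ, vert_mem_regPoly hn c' hρ' θ' j⟩
    · obtain ⟨l, a, hl, hmax, hk, hR⟩ := hsupp (Sum.inr (Sum.inl j))
      have hslice : ∀ x ∈ regPoly m c ρ θ, l (x, vert c' ρ' θ' j) = a := by
        intro x hx
        apply hR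
        refine ⟨?_, ?_⟩
        · rw [← hprod]; exact ⟨hx, vert_mem_regPoly hn c' hρ' θ' j⟩
        · rintro _ (rfl | rfl)
          · exact (edgeFun_vert_eq_iff hn hρ' j j).2 (Or.inl rfl)
          · exact (edgeFun_vert_eq_iff hn hρ' j _).2 (Or.inr rfl)
      have hsnd := exists_snd_of_const hspan₀ hslice
      refine ⟨l ∘ₗ LinearMap.inr ℝ _ _, a, ?_, ?_, ?_, ?_⟩
      · intro h
        apply hl
        apply LinearMap.ext
        rintro ⟨x, y⟩
        rw [hsnd]
        exact LinearMap.congr_fun h y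
      · rintro _ ⟨⟨x, y⟩, hy, rfl⟩
        have := hmax _ hy
        rwa [hsnd] at this
      · rw [LinearMap.comp_apply, LinearMap.inr_apply, ← hsnd c]
        exact hslice _ (center_mem hm hρ)
      · rw [LinearMap.comp_apply, LinearMap.inr_apply, ← hsnd (w (Sum.inr j)).1]
        exact hk _ (by simp [ridgePair])
  linarith

/-! ### Sufficiency: the twisted regular polygon circumscribed about the unit one. -/

section Cap

variable {m : ℕ}

/-- The circumradius of the regular `m`-gon circumscribed about the unit regular `m`-gon with
twist `φ`. -/
noncomputable def capRadius (m : ℕ) (φ : ℝ) : ℝ := Real.cos φ / Real.cos (Real.pi / m)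

/-- The vertex of the circumscribed polygon beyond the `i`-th edge of the unit regular `m`-gon. -/
noncomputable def capVert (φ : ℝ) (i : ZMod m) : EuclideanSpace ℝ (Fin 2) :=
  -- The shift to `i + 1` puts this vertex at angle φ + π/m + `ang i` modulo 2π, the normal
  -- direction of edge `i` turned by φ.
  vert 0 (capRadius m φ) (φ - Real.pi / m) (i + 1)

/-- The outer normal of the edge of the circumscribed polygon through the `i`-th vertex of the
unit regular `m`-gon. -/
noncomputable def capFun (φ : ℝ) (i : ZMod m) : EuclideanSpace ℝ (Fin 2) →ₗ[ℝ] ℝ :=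
  edgeFun (φ - Real.pi / m) i

/-- The value at `capVert φ i` of the outer normal of the `i`-th edge. -/
noncomputable def capHeight (m : ℕ) (φ : ℝ) : ℝ := capRadius m φ * Real.cos φ

variable {φ : ℝ}

lemma capRadius_mul (hm : 3 ≤ m) : capRadius m φ * Real.cos (Real.pi / m) = Real.cos φ :=
  div_mul_cancel₀ _ (cos_pi_div_pos hm).ne'

lemma cos_twist_pos (hm : 3 ≤ m) (hφ : |φ| < Real.pi / m) : 0 < Real.cos φ :=
  (cos_pi_div_pos hm).trans (cos_pi_div_lt hm hφ)

lemma capRadius_pos (hm : 3 ≤ m) (hφ : |φ| < Real.pi / m) : 0 < capRadius m φ :=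
  div_pos (cos_twist_pos hm hφ) (cos_pi_div_pos hm)

lemma cos_pi_div_lt_capHeight (hm : 3 ≤ m) (hφ : |φ| < Real.pi / m) :
    Real.cos (Real.pi / m) < capHeight m φ := by
  have h1 := cos_pi_div_lt hm hφ
  have h2 := cos_pi_div_pos hm
  rw [capHeight, capRadius, div_mul_eq_mul_div, lt_div_iff₀ h2]
  nlinarith

lemma capHeight_pos (hm : 3 ≤ m) (hφ : |φ| < Real.pi / m) : 0 < capHeight m φ :=
  (cos_pi_div_pos hm).trans (cos_pi_div_lt_capHeight hm hφ)

lemma cos_le_cos_of_between {δ x : ℝ} (hδ : 0 ≤ δ) (h1 : δ ≤ x)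
    (h2 : x ≤ 2 * Real.pi - δ) : Real.cos x ≤ Real.cos δ := by
  rcases h1.eq_or_lt with rfl | h1
  · exact le_rfl
  · rcases h2.eq_or_lt with rfl | h2
    · rw [Real.cos_two_pi_sub]
    · exact (cos_lt_cos_of_between hδ h1 h2).le

lemma edgeVal_cap (hm : 3 ≤ m) (i : ZMod m) :
    edgeVal 0 (capRadius m φ) (φ - Real.pi / m) i = Real.cos φ := by
  rw [edgeVal_zero, capRadius_mul hm]

lemma regPoly_cap (hm : 3 ≤ m) : regPoly m 0 (capRadius m φ) (φ - Real.pi / m) =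
    hpoly (capFun (m := m) φ) fun _ => Real.cos φ := by
  ext x
  exact forall_congr' fun k => by rw [edgeVal_cap hm]; rfl

variable [NeZero m]

lemma dirFun_add_ang_add_one (hm : 3 ≤ m) (γ : ℝ) (i : ZMod m) :
    dirFun (γ + ang (i + 1)) = dirFun (γ + 2 * Real.pi / m + ang i) := by
  have h1 := cos_add_ang_add_one hm γ i
  have h2 := cos_add_ang_add_one hm (γ - Real.pi / 2) i
  rw [show γ - Real.pi / 2 + ang (i + 1) = γ + ang (i + 1) - Real.pi / 2 by ring,
    show γ - Real.pi / 2 + 2 * Real.pi / m + ang i =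
      γ + 2 * Real.pi / m + ang i - Real.pi / 2 by ring,
    Real.cos_sub_pi_div_two, Real.cos_sub_pi_div_two] at h2
  ext x
  rw [dirFun_apply, dirFun_apply, h1, h2]

lemma edgeFun_capVert (hm : 3 ≤ m) (i k : ZMod m) : edgeFun 0 k (capVert φ i) =
    capRadius m φ * Real.cos (-φ + ang (k - i)) := by
  have h1 := edgeFun_dirVec 0 (φ - Real.pi / m) k (i + 1)
  have h2 := cos_add_ang_add_one hm (-φ) (k - (i + 1))
  rw [zero_add] at h1
  rw [capVert, vert, zero_add, map_smul, h1, smul_eq_mul, show k - i = k - (i + 1) + 1 by ring, h2]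
  ring_nf

lemma edgeFun_capVert_self (hm : 3 ≤ m) (i : ZMod m) :
    edgeFun 0 i (capVert φ i) = capHeight m φ := by
  rw [edgeFun_capVert hm, sub_self, ang_zero, add_zero, Real.cos_neg, capHeight]

/-- With a = `ang (k - i)`, the product formula gives 2 cos φ cos(a - φ) = cos a + cos(a - 2φ), and
this is less than cos(2π/m) + 1 = 2 cos²(π/m). -/
lemma edgeFun_capVert_lt (hm : 3 ≤ m) (hφ : |φ| < Real.pi / m) {i k : ZMod m} (hk : k ≠ i) :
    edgeFun 0 k (capVert φ i) < Real.cos (Real.pi / m) := by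
  have hκ := cos_pi_div_pos hm
  have hb := ang_bounds (sub_ne_zero.2 hk)
  have h0 := pi_div_pos hm
  have hφ' := abs_lt.1 hφ
  set a := ang (k - i)
  have h1 : Real.cos a ≤ Real.cos (2 * (Real.pi / m)) :=
    cos_le_cos_of_between (by linarith) hb.1 hb.2
  have h2 : Real.cos (a - 2 * φ) < 1 := by
    rw [← Real.cos_zero]
    exact cos_lt_cos_of_between le_rfl (by linarith) (by linarith)
  rw [Real.cos_two_mul] at h1
  have h3 : 2 * (Real.cos φ * Real.cos (-φ + a)) = Real.cos a + Real.cos (a - 2 * φ) := by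
    rw [show Real.cos a = Real.cos (φ + (-φ + a)) by ring_nf,
      show a - 2 * φ = (-φ + a) - φ by ring, Real.cos_add φ, Real.cos_sub]
    ring
  rw [edgeFun_capVert hm, capRadius, div_mul_eq_mul_div, div_lt_iff₀ hκ]
  nlinarith

lemma edgeFun_capVert_le (hm : 3 ≤ m) (hφ : |φ| < Real.pi / m) (i k : ZMod m) :
    edgeFun 0 k (capVert φ i) ≤ capHeight m φ := by
  by_cases h : k = i
  · rw [h, edgeFun_capVert_self hm]
  · exact ((edgeFun_capVert_lt hm hφ h).trans (cos_pi_div_lt_capHeight hm hφ)).le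

lemma edgeFun_capVert_eq_iff (hm : 3 ≤ m) (hφ : |φ| < Real.pi / m) (i k : ZMod m) :
    edgeFun 0 k (capVert φ i) = capHeight m φ ↔ i = k := by
  constructor
  · intro h
    by_contra hne
    exact ((edgeFun_capVert_lt hm hφ (Ne.symm hne)).trans (cos_pi_div_lt_capHeight hm hφ)).ne h
  · rintro rfl
    exact edgeFun_capVert_self hm _

lemma capFun_capVert_le (hm : 3 ≤ m) (hφ : |φ| < Real.pi / m) (i k : ZMod m) :
    capFun φ k (capVert φ i) ≤ Real.cos φ := by
  have := vert_mem_regPoly hm 0 (capRadius_pos hm hφ) (φ - Real.pi / m) (i + 1) k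
  rwa [edgeVal_cap hm] at this

lemma capFun_capVert_eq_iff (hm : 3 ≤ m) (hφ : |φ| < Real.pi / m) (i k : ZMod m) :
    capFun φ k (capVert φ i) = Real.cos φ ↔ i = k ∨ i = k - 1 := by
  have := edgeFun_vert_eq_iff (c := 0) (θ := φ - Real.pi / m) hm (capRadius_pos hm hφ) (i + 1) k
  rw [edgeVal_cap hm, add_sub_cancel_right] at this
  rw [capFun, capVert, this]
  constructor
  · rintro (rfl | rfl)
    · right; ring
    · left; rfl
  · rintro (rfl | rfl)
    · right; rfl
    · left; ring

lemma capFun_vert (i k : ZMod m) : capFun φ k (vert 0 1 0 i) = Real.cos (φ + ang (k - i)) := by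
  have := edgeFun_dirVec (φ - Real.pi / m) (-(φ - Real.pi / m)) k i
  rw [add_neg_cancel] at this
  rw [capFun, vert, zero_add, one_smul, this]
  ring_nf

lemma capFun_vert_self (i : ZMod m) : capFun φ i (vert 0 1 0 i) = Real.cos φ := by
  rw [capFun_vert, sub_self, ang_zero, add_zero]

lemma capFun_vert_lt (hm : 3 ≤ m) (hφ : |φ| < Real.pi / m) {i k : ZMod m} (hk : k ≠ i) :
    capFun φ k (vert 0 1 0 i) < Real.cos φ := by
  rw [capFun_vert]
  exact (cos_add_ang_lt hm hφ (sub_ne_zero.2 hk)).trans (cos_pi_div_lt hm hφ)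

/-- The normals of the circumscribed polygon are positive combinations of those of the inscribed
polygon. -/
lemma capFun_combination (hm : 3 ≤ m) (hφ : |φ| < Real.pi / m) (i : ZMod m) :
    ∃ a b : ℝ, 0 < a ∧ 0 < b ∧ (a + b) * Real.cos (Real.pi / m) = Real.cos φ ∧
      ∀ x, capFun φ i x = a * edgeFun 0 i x + b * edgeFun 0 (i - 1) x := by
  have h0 := pi_div_pos hm
  have h1 := pi_div_le hm
  have hpi := Real.pi_pos
  have hφ' := abs_lt.1 hφ
  have hκ := cos_pi_div_pos hm
  have hs : 0 < Real.sin (Real.pi / m) := Real.sin_pos_of_pos_of_lt_pi h0 (by linarith)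
  have hp : 0 < Real.sin (Real.pi / m + φ) :=
    Real.sin_pos_of_pos_of_lt_pi (by linarith) (by linarith)
  have hq : 0 < Real.sin (Real.pi / m - φ) :=
    Real.sin_pos_of_pos_of_lt_pi (by linarith) (by linarith)
  have hd : 0 < 2 * Real.sin (Real.pi / m) * Real.cos (Real.pi / m) := by positivity
  -- The coefficients are sin(π/m ± φ) / sin(2π/m); they are positive precisely because |φ| < π/m.
  refine ⟨_, _, div_pos hp hd, div_pos hq hd, ?_, fun x => ?_⟩
  · rw [Real.sin_add, Real.sin_sub]
    field_simp
    ring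
  · have e : edgeFun 0 (i - 1) = dirFun (-(Real.pi / m) + ang i) := by
      have := dirFun_add_ang_add_one hm (-(Real.pi / m)) (i - 1)
      rw [sub_add_cancel] at this
      rw [this, edgeFun]
      congr 1
      ring
    rw [e, capFun, edgeFun, edgeFun, dirFun_apply, dirFun_apply, dirFun_apply,
      show φ - Real.pi / m + Real.pi / m + ang i = φ + ang i by ring, zero_add]
    have hsq := Real.sin_sq_add_cos_sq (Real.pi / m)
    simp only [Real.sin_add, Real.cos_add, Real.sin_sub, Real.cos_neg, Real.sin_neg]
    field_simp
    ring

lemma capFun_le (hm : 3 ≤ m) (hφ : |φ| < Real.pi / m) {x : EuclideanSpace ℝ (Fin 2)}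
    (hx : x ∈ regPoly m 0 1 0) (i : ZMod m) : capFun φ i x ≤ Real.cos φ := by
  obtain ⟨a, b, ha, hb, hab, h⟩ := capFun_combination hm hφ i
  have h1 := hx i
  have h2 := hx (i - 1)
  rw [edgeVal_zero, one_mul] at h1 h2
  rw [h, ← hab]
  nlinarith

/-- Equality in a positive combination of valid inequalities forces equality in each, so the
circumscribed edge touches the inscribed polygon only where two of its edges meet. -/
lemma capFun_eq_iff (hm : 3 ≤ m) (hφ : |φ| < Real.pi / m) {x : EuclideanSpace ℝ (Fin 2)}
    (hx : x ∈ regPoly m 0 1 0) (i : ZMod m) : capFun φ i x = Real.cos φ ↔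
      edgeFun 0 i x = edgeVal 0 1 0 i ∧ edgeFun 0 (i - 1) x = edgeVal 0 1 0 (i - 1) := by
  obtain ⟨a, b, ha, hb, hab, h⟩ := capFun_combination hm hφ i
  have h1 := hx i
  have h2 := hx (i - 1)
  rw [edgeVal_zero, one_mul] at h1 h2
  rw [h, ← hab, edgeVal_zero, edgeVal_zero, one_mul]
  constructor
  · intro h3
    have h4 : 0 ≤ a * (Real.cos (Real.pi / m) - edgeFun 0 i x) := mul_nonneg ha.le (by linarith)
    have h5 : 0 ≤ b * (Real.cos (Real.pi / m) - edgeFun 0 (i - 1) x) :=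
      mul_nonneg hb.le (by linarith)
    have h6 : a * (Real.cos (Real.pi / m) - edgeFun 0 i x) = 0 := by linarith
    have h7 : b * (Real.cos (Real.pi / m) - edgeFun 0 (i - 1) x) = 0 := by linarith
    rw [mul_eq_zero, or_iff_right ha.ne'] at h6
    rw [mul_eq_zero, or_iff_right hb.ne'] at h7
    constructor <;> linarith
  · rintro ⟨h3, h4⟩
    rw [h3, h4]; ring

/-- A point of the circumscribed polygon beyond an edge of the inscribed polygon lies in the
triangle that the vertex of the circumscribed polygon spans with the edge. -/
lemma exists_triangle_coords (hm : 3 ≤ m) (hφ : |φ| < Real.pi / m) {x : EuclideanSpace ℝ (Fin 2)}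
    (hx : ∀ k : ZMod m, capFun φ k x ≤ Real.cos φ) {i : ZMod m}
    (hi : Real.cos (Real.pi / m) ≤ edgeFun 0 i x) :
    ∃ s : ℝ, 0 ≤ s ∧ s ≤ 1 ∧
      edgeFun 0 i x = Real.cos (Real.pi / m) + s * (capHeight m φ - Real.cos (Real.pi / m)) ∧
      ∃ z ∈ regPoly m 0 1 0, x = s • capVert φ i + (1 - s) • z := by
  have hH := cos_pi_div_lt_capHeight hm hφ
  have hne := one_ne_zero_zmod hm
  set w := vert (m := m) 0 1 0 with hw
  set κ := Real.cos (Real.pi / m) with hκ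
  have a1 : capFun φ i (w i) = Real.cos φ := capFun_vert_self i
  have a2 : capFun φ i (w (i + 1)) < Real.cos φ :=
    capFun_vert_lt hm hφ fun h => hne (by linear_combination -h)
  have a3 : capFun φ (i + 1) (w i) < Real.cos φ :=
    capFun_vert_lt hm hφ fun h => hne (by linear_combination h)
  have a4 : capFun φ (i + 1) (w (i + 1)) = Real.cos φ := capFun_vert_self _
  have a5 : capFun φ i (capVert φ i) = Real.cos φ :=
    (capFun_capVert_eq_iff hm hφ i i).2 (Or.inl rfl)
  have a6 : capFun φ (i + 1) (capVert φ i) = Real.cos φ :=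
    (capFun_capVert_eq_iff hm hφ i (i + 1)).2 (Or.inr (by ring))
  have a7 : edgeFun 0 i (w i) = κ := by
    have := (edgeFun_vert_eq_iff (c := 0) (θ := 0) hm one_pos i i).2 (Or.inl rfl)
    rwa [edgeVal_zero, one_mul] at this
  have a8 : edgeFun 0 i (w (i + 1)) = κ := by
    have := (edgeFun_vert_eq_iff (c := 0) (θ := 0) hm one_pos (i + 1) i).2 (Or.inr (by ring))
    rwa [edgeVal_zero, one_mul] at this
  have a9 : edgeFun 0 i (capVert φ i) = capHeight m φ := edgeFun_capVert_self hm i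
  -- Barycentric coordinates in the triangle on `capVert φ i`, `w i`, `w (i + 1)`: `edgeFun 0 i` is
  -- constant on the base and gives `s`, `capFun φ i` is constant on the side through `w i` and
  -- gives `t`, and `capFun φ (i + 1)` gives nonnegativity of the third.
  set s := (edgeFun 0 i x - κ) / (capHeight m φ - κ) with hs
  have hs0 : 0 ≤ s := div_nonneg (by linarith) (by linarith)
  have hsm : s * (capHeight m φ - κ) = edgeFun 0 i x - κ := div_mul_cancel₀ _ (by linarith)
  set t := (Real.cos φ - capFun φ i x) / (Real.cos φ - capFun φ i (w (i + 1))) with ht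
  have ht0 : 0 ≤ t := div_nonneg (by linarith [hx i]) (by linarith)
  have htm : t * (Real.cos φ - capFun φ i (w (i + 1))) = Real.cos φ - capFun φ i x :=
    div_mul_cancel₀ _ (by linarith)
  have hxe : x = s • capVert φ i + (1 - s - t) • w i + t • w (i + 1) := by
    rw [← sub_eq_zero]
    refine eq_zero_of_dirFun_eq_zero (α := 0 + Real.pi / m + ang i)
      (β := φ - Real.pi / m + Real.pi / m + ang i) ?_ ?_ ?_
    · have h0 := pi_div_pos hm
      have h1 := pi_div_le hm
      have hpi := Real.pi_pos
      have hφ' := abs_lt.1 hφ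
      apply ne_of_gt
      apply Real.sin_pos_of_pos_of_lt_pi <;> linarith
    · change edgeFun 0 i _ = 0
      simp only [map_sub, map_add, map_smul, smul_eq_mul, a7, a8, a9]
      linarith
    · change capFun φ i _ = 0
      simp only [map_sub, map_add, map_smul, smul_eq_mul, a1, a5]
      linarith
  have hr0 : 0 ≤ 1 - s - t := by
    have := hx (i + 1)
    rw [hxe] at this
    simp only [map_add, map_smul, smul_eq_mul, a4, a6] at this
    by_contra! h
    nlinarith
  refine ⟨s, hs0, by linarith, by linarith, ?_⟩
  rcases eq_or_lt_of_le (show s ≤ 1 by linarith) with h | h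
  · refine ⟨0, center_mem hm one_pos, ?_⟩
    have h1 : t = 0 := by linarith
    rw [h1, h] at hxe
    rw [h]
    simpa using hxe
  · have h1 : 0 < 1 - s := by linarith
    refine ⟨((1 - s - t) / (1 - s)) • w i + (t / (1 - s)) • w (i + 1), ?_, ?_⟩
    · refine convex_hpoly (vert_mem_regPoly hm 0 one_pos 0 i)
        (vert_mem_regPoly hm 0 one_pos 0 (i + 1)) (div_nonneg hr0 h1.le) (div_nonneg ht0 h1.le) ?_
      field_simp
      ring
    · rw [smul_add, smul_smul, smul_smul, mul_div_cancel₀ _ h1.ne', mul_div_cancel₀ _ h1.ne',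
        ← add_assoc]
      exact hxe

/-- The case `t = 0`, which occurs at the new vertices, needs its own argument: nonpositive values
summing to zero all vanish. -/
lemma exists_eq_smul_of_edgeFun_le (hm : 3 ≤ m) {y : EuclideanSpace ℝ (Fin 2)} {t : ℝ} (ht : 0 ≤ t)
    (hy : ∀ j : ZMod m, edgeFun 0 j y ≤ t * Real.cos (Real.pi / m)) :
    ∃ z ∈ regPoly m 0 1 0, y = t • z := by
  rcases ht.eq_or_lt with rfl | ht
  · refine ⟨0, center_mem hm one_pos, ?_⟩
    simp only [zero_mul] at hy
    have h := (Finset.sum_eq_zero_iff_of_nonpos fun j _ => hy j).1 (sum_edgeFun hm 0 y)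
    rw [zero_smul]
    exact eq_zero_of_edgeFun hm (i := 0) (h _ (Finset.mem_univ _)) (h _ (Finset.mem_univ _))
  · refine ⟨t⁻¹ • y, fun j => ?_, by rw [smul_smul, mul_inv_cancel₀ ht.ne', one_smul]⟩
    rw [edgeVal_zero, one_mul, map_smul, smul_eq_mul, inv_mul_le_iff₀ ht]
    exact hy j

lemma mem_frontier_hpoly {K : Type*} {f : K → EuclideanSpace ℝ (Fin 2) →ₗ[ℝ] ℝ} {b : K → ℝ}
    {q o : EuclideanSpace ℝ (Fin 2)} (hq : q ∈ hpoly f b) {k : K} (hk : f k q = b k)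
    (ho : f k o < b k) : q ∈ frontier (hpoly f b) := by
  refine ⟨subset_closure hq, fun hint => ?_⟩
  have hc : Continuous fun ε : ℝ => q + ε • (q - o) := by fun_prop
  have h1 : ∀ᶠ ε : ℝ in nhds 0, q + ε • (q - o) ∈ interior (hpoly f b) :=
    hc.continuousAt.eventually_mem (isOpen_interior.mem_nhds (by simpa using hint))
  obtain ⟨ε, hε, h2⟩ := ((h1.filter_mono nhdsWithin_le_nhds).and
    (self_mem_nhdsWithin : Set.Ioi (0 : ℝ) ∈ nhdsWithin 0 (Set.Ioi 0))).exists
  have h3 := interior_subset hε k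
  rw [map_add, map_smul, map_sub, hk, smul_eq_mul] at h3
  have h4 : (0 : ℝ) < ε := h2
  nlinarith

/-- Scaling the new vertex by κ/H, with H its height over the centre, puts it on edge `i`. No other
edge inequality is violated, since none takes a value above H at the vertex. -/
lemma hasOutsideFraction_capVert (hm : 3 ≤ m) (hφ : |φ| < Real.pi / m) (i : ZMod m) :
    HasOutsideFraction (regPoly m 0 1 0) (capVert φ i) 0
      (1 - Real.cos (Real.pi / m) / capHeight m φ) := by
  have hH := capHeight_pos hm hφ
  have hκ := cos_pi_div_pos hm
  have hlt := cos_pi_div_lt_capHeight hm hφ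
  set μ := Real.cos (Real.pi / m) / capHeight m φ with hμ
  have hμ0 : 0 < μ := div_pos hκ hH
  have hμ1 : μ < 1 := (div_lt_one hH).2 hlt
  have hμH : μ * capHeight m φ = Real.cos (Real.pi / m) := div_mul_cancel₀ _ hH.ne'
  have hq : μ • capVert φ i + (1 - μ) • (0 : EuclideanSpace ℝ (Fin 2)) = μ • capVert φ i := by simp
  refine ⟨μ • capVert φ i, ⟨μ, 1 - μ, hμ0.le, by linarith, by ring, hq⟩, ?_,
    dist_eq_of_affine (by linarith) (by ring) hq⟩
  refine mem_frontier_hpoly (k := i) (o := 0) (fun k => ?_) ?_ (edgeFun_center_lt hm one_pos i)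
  · rw [edgeVal_zero, one_mul, map_smul, smul_eq_mul, ← hμH]
    exact mul_le_mul_of_nonneg_left (edgeFun_capVert_le hm hφ i k) hμ0.le
  · rw [edgeVal_zero, one_mul, map_smul, smul_eq_mul, ← hμH, edgeFun_capVert_self hm]

/-- `U` is squeezed between the hull of the circumscribed vertices and the intersection of the
corresponding half-planes, which coincide. -/
lemma isRegularPolygon_cap (hm : 3 ≤ m) (hφ : |φ| < Real.pi / m)
    {U : Set (EuclideanSpace ℝ (Fin 2))} (hU : Convex ℝ U)
    (h1 : ∀ i : ZMod m, capVert φ i ∈ U)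
    (h2 : ∀ x ∈ U, ∀ k : ZMod m, capFun φ k x ≤ Real.cos φ) : IsRegularPolygon m U := by
  rw [isRegularPolygon_iff hm]
  refine ⟨0, capRadius m φ, φ - Real.pi / m, capRadius_pos hm hφ, Set.Subset.antisymm ?_ ?_⟩
  · rw [regPoly_cap hm]
    exact h2
  · rw [← convexHull_vert hm 0 (capRadius_pos hm hφ)]
    refine convexHull_min ?_ hU
    rintro _ ⟨i, rfl⟩
    have := h1 (i - 1)
    rwa [capVert, sub_add_cancel] at this

end Cap

/-! ### Sufficiency: the explicit realisation. -/

section Realisation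

variable {m n : ℕ}

/-- The facet normals of the realisation. -/
noncomputable def eFun (m n : ℕ) (φ ψ : ℝ) : ZMod m ⊕ ZMod n ⊕ ZMod m × ZMod n →
    EuclideanSpace ℝ (Fin 2) × EuclideanSpace ℝ (Fin 2) →ₗ[ℝ] ℝ
  | Sum.inl i => capFun φ i ∘ₗ LinearMap.fst ℝ _ _
  | Sum.inr (Sum.inl j) => capFun ψ j ∘ₗ LinearMap.snd ℝ _ _
  | Sum.inr (Sum.inr (i, j)) =>
    (capHeight m φ)⁻¹ • (edgeFun 0 i ∘ₗ LinearMap.fst ℝ _ _) +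
      (capHeight n ψ)⁻¹ • (edgeFun 0 j ∘ₗ LinearMap.snd ℝ _ _)

/-- The right-hand sides of the facet inequalities of the realisation. -/
noncomputable def eVal (m n : ℕ) (φ ψ : ℝ) : ZMod m ⊕ ZMod n ⊕ ZMod m × ZMod n → ℝ
  | Sum.inl _ => Real.cos φ
  | Sum.inr (Sum.inl _) => Real.cos ψ
  | Sum.inr (Sum.inr _) => 1

/-- The new vertices of the realisation. -/
noncomputable def eVert (m n : ℕ) (φ ψ : ℝ) : ZMod m ⊕ ZMod n →
    EuclideanSpace ℝ (Fin 2) × EuclideanSpace ℝ (Fin 2)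
  | Sum.inl i => (capVert φ i, 0)
  | Sum.inr j => (0, capVert ψ j)

variable {φ ψ : ℝ}

@[simp] lemma eFun_inl (i : ZMod m) (x : EuclideanSpace ℝ (Fin 2) × EuclideanSpace ℝ (Fin 2)) :
    eFun m n φ ψ (Sum.inl i) x = capFun φ i x.1 := rfl

@[simp] lemma eFun_inr_inl (j : ZMod n)
    (x : EuclideanSpace ℝ (Fin 2) × EuclideanSpace ℝ (Fin 2)) :
    eFun m n φ ψ (Sum.inr (Sum.inl j)) x = capFun ψ j x.2 := rfl

@[simp] lemma eFun_inr_inr (i : ZMod m) (j : ZMod n)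
    (x : EuclideanSpace ℝ (Fin 2) × EuclideanSpace ℝ (Fin 2)) :
    eFun m n φ ψ (Sum.inr (Sum.inr (i, j))) x =
      (capHeight m φ)⁻¹ * edgeFun 0 i x.1 + (capHeight n ψ)⁻¹ * edgeFun 0 j x.2 := rfl

@[simp] lemma eVal_inl (i : ZMod m) : eVal m n φ ψ (Sum.inl i) = Real.cos φ := rfl

@[simp] lemma eVal_inr_inl (j : ZMod n) : eVal m n φ ψ (Sum.inr (Sum.inl j)) = Real.cos ψ := rfl

@[simp] lemma eVal_inr_inr (p : ZMod m × ZMod n) :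
    eVal m n φ ψ (Sum.inr (Sum.inr p)) = 1 := rfl

@[simp] lemma eVert_inl (i : ZMod m) : eVert m n φ ψ (Sum.inl i) = (capVert φ i, 0) := rfl

@[simp] lemma eVert_inr (j : ZMod n) : eVert m n φ ψ (Sum.inr j) = (0, capVert ψ j) := rfl

lemma inv_mul_add_le {H H' x y κ κ' : ℝ} (hH : 0 < H) (hH' : 0 < H') (h : κ / H + κ' / H' = 1)
    (hx : x ≤ κ) (hy : y ≤ κ') : H⁻¹ * x + H'⁻¹ * y ≤ 1 := by
  rw [← h, div_eq_inv_mul, div_eq_inv_mul]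
  gcongr

lemma inv_mul_add_eq_iff {H H' x y κ κ' : ℝ} (hH : 0 < H) (hH' : 0 < H')
    (h : κ / H + κ' / H' = 1) (hx : x ≤ κ) (hy : y ≤ κ') :
    H⁻¹ * x + H'⁻¹ * y = 1 ↔ x = κ ∧ y = κ' := by
  rw [← h, div_eq_inv_mul, div_eq_inv_mul,
    add_eq_add_iff_eq_and_eq (by gcongr) (by gcongr),
    mul_right_inj' (inv_ne_zero hH.ne'), mul_right_inj' (inv_ne_zero hH'.ne')]

/-- Since 1 - κ/H = κ'/H', climbing a fraction `s` of the cap in one factor leaves room for exactly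
the (1 - s)-scaled polygon in the other. This is how the ratios adding up to one make the pyramids
fit together. -/
lemma le_mul_of_inv_mul_add_le {H H' x y κ κ' s : ℝ} (hH : 0 < H) (hH' : 0 < H')
    (h : κ / H + κ' / H' = 1) (hx : x = κ + s * (H - κ)) (hxy : H⁻¹ * x + H'⁻¹ * y ≤ 1) :
    y ≤ (1 - s) * κ' := by
  have e1 : H⁻¹ * x = κ / H + s * (1 - κ / H) := by
    rw [hx]
    field_simp
  have e2 : H'⁻¹ * y ≤ (1 - s) * (κ' / H') := by
    have : 1 - κ / H = κ' / H' := by linarith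
    rw [e1, this] at hxy
    nlinarith
  rw [← mul_div_assoc, div_eq_inv_mul] at e2
  exact le_of_mul_le_mul_left e2 (inv_pos.2 hH')

variable [NeZero m] [NeZero n]

/-- The explicit realisation for twists whose intersection ratios add up to one. -/
theorem isRegularRealisation_hpoly (hm : 3 ≤ m) (hn : 3 ≤ n) (hφ : |φ| < Real.pi / m)
    (hψ : |ψ| < Real.pi / n)
    (h : Real.cos (Real.pi / m) / capHeight m φ + Real.cos (Real.pi / n) / capHeight n ψ = 1) :
    IsRegularRealisation m n (hpoly (eFun m n φ ψ) (eVal m n φ ψ)) := by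
  have hH := capHeight_pos hm hφ
  have hH' := capHeight_pos hn hψ
  have hκ := cos_pi_div_pos hm
  have hκ' := cos_pi_div_pos hn
  have hlt := cos_pi_div_lt_capHeight hm hφ
  have hlt' := cos_pi_div_lt_capHeight hn hψ
  have hc := cos_twist_pos hm hφ
  have hc' := cos_twist_pos hn hψ
  have hv1 : ∀ i : ZMod m, edgeVal 0 1 0 i = Real.cos (Real.pi / m) := fun i => by
    rw [edgeVal_zero, one_mul]
  have hv2 : ∀ i : ZMod n, edgeVal 0 1 0 i = Real.cos (Real.pi / n) := fun i => by
    rw [edgeVal_zero, one_mul]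
  have hprod : hpoly (ppFun m n 0 0) (ppVal m n 0 1 0 0 1 0) =
      regPoly m 0 1 0 ×ˢ regPoly n 0 1 0 := hpoly_prodFun
  have hcen := ppFun_center_lt (c := 0) (θ := 0) (c' := 0) (θ' := 0) hm hn one_pos one_pos
  have hfac := exists_tight_facet (c := 0) (θ := 0) (c' := 0) (θ' := 0) hm hn one_pos one_pos
  have hx1 : ∀ {x : EuclideanSpace ℝ (Fin 2)}, x ∈ regPoly m 0 1 0 → ∀ i,
      edgeFun 0 i x ≤ Real.cos (Real.pi / m) := fun hx i => (hx i).trans_eq (hv1 i)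
  have hx2 : ∀ {x : EuclideanSpace ℝ (Fin 2)}, x ∈ regPoly n 0 1 0 → ∀ i,
      edgeFun 0 i x ≤ Real.cos (Real.pi / n) := fun hx i => (hx i).trans_eq (hv2 i)
  have hPQ : hpoly (ppFun m n 0 0) (ppVal m n 0 1 0 0 1 0) ⊆
      hpoly (eFun m n φ ψ) (eVal m n φ ψ) := by
    rw [hprod]
    rintro ⟨x, y⟩ ⟨hx, hy⟩ (i | j | ⟨i, j⟩)
    · exact capFun_le hm hφ hx i
    · exact capFun_le hn hψ hy j
    · exact inv_mul_add_le hH hH' h (hx1 hx i) (hx2 hy j)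
  have hptQ : ∀ k, eVert m n φ ψ k ∈ hpoly (eFun m n φ ψ) (eVal m n φ ψ) := by
    rintro (k | k) (i | j | ⟨i, j⟩)
    · exact capFun_capVert_le hm hφ k i
    · simpa using hc'.le
    · simpa [inv_mul_le_iff₀ hH] using edgeFun_capVert_le hm hφ k i
    · simpa using hc.le
    · exact capFun_capVert_le hn hψ k j
    · simpa [inv_mul_le_iff₀ hH'] using edgeFun_capVert_le hn hψ k j
  -- Different inequalities define different facets, so a new vertex can be prescribed for each
  -- facet; elsewhere the value is the default 0.
  set v := Function.extend
    (fun k => hface (ppFun m n 0 0) (ppVal m n 0 1 0 0 1 0) {k}) (eVert m n φ ψ) 0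
  have hv : ∀ k, v (hface (ppFun m n 0 0) (ppVal m n 0 1 0 0 1 0) {k}) = eVert m n φ ψ k :=
    fun k => (hface_singleton_injective hfac).extend_apply _ _ k
  have hF₀ : ∀ i : ZMod m, v (hface (edgeFun 0) (edgeVal 0 1 0) {i} ×ˢ regPoly n 0 1 0) =
      (capVert φ i, 0) := fun i => by
    have := hv (Sum.inl i)
    rwa [hface_prodFun_inl] at this
  have hF₁ : ∀ j : ZMod n, v (regPoly m 0 1 0 ×ˢ hface (edgeFun 0) (edgeVal 0 1 0) {j}) =
      (0, capVert ψ j) := fun j => by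
    have := hv (Sum.inr j)
    rwa [hface_prodFun_inr] at this
  refine ⟨regPoly m 0 1 0, regPoly n 0 1 0, v, ?_, (isRegularPolygon_iff hm _).2
    ⟨0, 1, 0, one_pos, rfl⟩, (isRegularPolygon_iff hn _).2 ⟨0, 1, 0, one_pos, rfl⟩, ?_, ?_,
    ⟨1 - Real.cos (Real.pi / m) / capHeight m φ, ?_⟩,
    ⟨1 - Real.cos (Real.pi / n) / capHeight n ψ, ?_⟩⟩
  · rw [← hprod]
    refine isVertexPreservingE_hpoly (T := ridgePair) (pt := eVert m n φ ψ) (o := (0, 0)) hcen ?_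
      hfac (isRidge_iff hm hn one_pos one_pos) ridgePair_nonempty
      (exists_tight_ridge hm hn one_pos one_pos) ?_ ?_ hPQ hptQ ?_ ?_ ?_ ?_ hv
    · rintro (i | j | ⟨i, j⟩)
      · simpa using hc
      · simpa using hc'
      · simp
    · rintro (i | j)
      · simpa [hv1, edgeFun_capVert_self hm] using hlt
      · simpa [hv2, edgeFun_capVert_self hn] using hlt'
    · rintro (k | k) (i | j) hne
      · simpa [hv1] using edgeFun_capVert_lt hm hφ (i := k) (k := i) (by simpa using hne)
      · simpa [hv2] using hκ'
      · simpa [hv1] using hκ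
      · simpa [hv2] using edgeFun_capVert_lt hn hψ (i := k) (k := j) (by simpa using hne)
    · rw [hprod]
      rintro (i | j | ⟨i, j⟩) ⟨x, y⟩ ⟨hx, hy⟩
      · simpa [ridgePair] using capFun_eq_iff hm hφ hx i
      · simpa [ridgePair] using capFun_eq_iff hn hψ hy j
      · simpa [ridgePair, hv1, hv2] using inv_mul_add_eq_iff hH hH' h (hx1 hx i) (hx2 hy j)
    · rintro (i | j | ⟨i, j⟩) (k | k)
      · simpa [ridgePair] using capFun_capVert_eq_iff hm hφ k i
      · simpa [ridgePair] using hc.ne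
      · simpa [ridgePair] using hc'.ne
      · simpa [ridgePair] using capFun_capVert_eq_iff hn hψ k j
      · simpa [ridgePair, inv_mul_eq_iff_eq_mul₀ hH.ne'] using edgeFun_capVert_eq_iff hm hφ k i
      · simpa [ridgePair, inv_mul_eq_iff_eq_mul₀ hH'.ne'] using edgeFun_capVert_eq_iff hn hψ k j
    · rintro ⟨x, y⟩ hxy
      -- A point of the realisation beyond an edge of P₀ splits as `s` times a new vertex plus 1 -
      -- `s` times a point of P₀ × P₁, and symmetrically for P₁. If it is beyond no edge, it already
      -- lies in P₀ × P₁ and any new vertex serves as the other end.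
      by_cases hx : ∃ i : ZMod m, Real.cos (Real.pi / m) < edgeFun 0 i x
      · obtain ⟨i, hi⟩ := hx
        obtain ⟨s, hs0, hs1, hs, z, hz, hxz⟩ := exists_triangle_coords hm hφ (x := x)
          (fun k => hxy (Sum.inl k)) hi.le
        obtain ⟨z', hz', hyz⟩ := exists_eq_smul_of_edgeFun_le hn (y := y) (sub_nonneg.2 hs1)
          fun j => le_mul_of_inv_mul_add_le hH hH' h hs (hxy (Sum.inr (Sum.inr (i, j))))
        refine ⟨Sum.inl i, (z, z'), ?_, s, 1 - s, hs0, sub_nonneg.2 hs1, by ring, ?_⟩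
        · rw [hprod]; exact ⟨hz, hz'⟩
        · rw [eVert_inl, hyz, hxz]; simp
      · by_cases hy : ∃ j : ZMod n, Real.cos (Real.pi / n) < edgeFun 0 j y
        · obtain ⟨j, hj⟩ := hy
          obtain ⟨s, hs0, hs1, hs, z, hz, hyz⟩ := exists_triangle_coords hn hψ (x := y)
            (fun k => hxy (Sum.inr (Sum.inl k))) hj.le
          obtain ⟨z', hz', hxz⟩ := exists_eq_smul_of_edgeFun_le hm (y := x) (sub_nonneg.2 hs1)
            fun i => le_mul_of_inv_mul_add_le hH' hH (by rw [add_comm]; exact h) hs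
              (by rw [add_comm]; exact hxy (Sum.inr (Sum.inr (i, j))))
          refine ⟨Sum.inr j, (z', z), ?_, s, 1 - s, hs0, sub_nonneg.2 hs1, by ring, ?_⟩
          · rw [hprod]; exact ⟨hz', hz⟩
          · rw [eVert_inr, hyz, hxz]; simp
        · push Not at hx hy
          refine ⟨Sum.inl 0, (x, y), ?_, right_mem_segment ℝ _ _⟩
          rw [hprod]
          exact ⟨fun i => (hx i).trans_eq (hv1 i).symm, fun j => (hy j).trans_eq (hv2 j).symm⟩
    · have hμ : (capHeight m φ)⁻¹ * Real.cos (Real.pi / m) < 1 := by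
        rwa [inv_mul_lt_iff₀ hH, mul_one]
      have hμ' : (capHeight n ψ)⁻¹ * Real.cos (Real.pi / n) < 1 := by
        rwa [inv_mul_lt_iff₀ hH', mul_one]
      rintro (i | j | ⟨i, j⟩)
      · have hw := vert_mem_regPoly hm 0 one_pos 0 i
        refine ⟨(vert 0 1 0 i, 0), hPQ (by rw [hprod]; exact ⟨hw, center_mem hn one_pos⟩), ?_⟩
        ext (k | k | ⟨k, l⟩)
        · by_cases hk : k = i
          · simp [tight, hk, capFun_vert_self]
          · simpa [tight, hk] using (capFun_vert_lt hm hφ hk).ne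
        · simpa [tight] using hc'.ne
        · have := mul_le_mul_of_nonneg_left (hx1 hw k) (inv_pos.2 hH).le
          simpa [tight] using (this.trans_lt hμ).ne
      · have hw := vert_mem_regPoly hn 0 one_pos 0 j
        refine ⟨(0, vert 0 1 0 j), hPQ (by rw [hprod]; exact ⟨center_mem hm one_pos, hw⟩), ?_⟩
        ext (k | k | ⟨k, l⟩)
        · simpa [tight] using hc.ne
        · by_cases hk : k = j
          · simp [tight, hk, capFun_vert_self]
          · simpa [tight, hk] using (capFun_vert_lt hn hψ hk).ne
        · have := mul_le_mul_of_nonneg_left (hx2 hw l) (inv_pos.2 hH').le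
          simpa [tight] using (this.trans_lt hμ').ne
      -- For a ridge edge × edge, the midpoint of its two new vertices is tight for the associated
      -- facet only.
      · have hmid : (1 / 2 : ℝ) • eVert m n φ ψ (Sum.inl i) +
            (1 / 2 : ℝ) • eVert m n φ ψ (Sum.inr j) =
            ((1 / 2 : ℝ) • capVert φ i, (1 / 2 : ℝ) • capVert ψ j) := by simp
        refine ⟨((1 / 2 : ℝ) • capVert φ i, (1 / 2 : ℝ) • capVert ψ j), ?_, ?_⟩
        · rw [← hmid]
          exact convex_hpoly (hptQ _) (hptQ _) (by norm_num) (by norm_num) (by norm_num)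
        · ext (k | k | ⟨k, l⟩)
          · have := capFun_capVert_le hm hφ i k
            have : (1 / 2 : ℝ) * capFun φ k (capVert φ i) ≠ Real.cos φ := by
              intro h; linarith
            simpa [tight] using this
          · have := capFun_capVert_le hn hψ j k
            have : (1 / 2 : ℝ) * capFun ψ k (capVert ψ j) ≠ Real.cos ψ := by
              intro h; linarith
            simpa [tight] using this
          -- With κ and κ' replaced by half the heights, the two bounds contribute 1/2 each, so
          -- tightness forces both indices to agree.
          · have e := inv_mul_add_eq_iff hH hH' (κ := 1 / 2 * capHeight m φ)
              (κ' := 1 / 2 * capHeight n ψ) (x := 1 / 2 * edgeFun 0 k (capVert φ i))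
              (y := 1 / 2 * edgeFun 0 l (capVert ψ j)) (by field_simp; norm_num)
              (by linarith [edgeFun_capVert_le hm hφ i k])
              (by linarith [edgeFun_capVert_le hn hψ j l])
            rw [mul_right_inj' (by norm_num), mul_right_inj' (by norm_num),
              edgeFun_capVert_eq_iff hm hφ, edgeFun_capVert_eq_iff hn hψ] at e
            simp only [tight, Set.mem_ofPred_eq, eFun_inr_inr, eVal_inr_inr, map_smul,
              smul_eq_mul, e, Set.mem_singleton_iff, Sum.inr.injEq, Prod.mk.injEq]
            tauto
  · refine isRegularPolygon_cap hm hφ (convex_hpoly.is_linear_image ⟨fun _ _ => rfl, fun _ _ => rfl⟩)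
      (fun i => ⟨_, hptQ (Sum.inl i), rfl⟩) ?_
    rintro _ ⟨x, hx, rfl⟩ k
    exact hx (Sum.inl k)
  · refine isRegularPolygon_cap hn hψ (convex_hpoly.is_linear_image ⟨fun _ _ => rfl, fun _ _ => rfl⟩)
      (fun i => ⟨_, hptQ (Sum.inr i), rfl⟩) ?_
    rintro _ ⟨x, hx, rfl⟩ k
    exact hx (Sum.inr (Sum.inl k))
  · intro F₀ F₁ h₀ h₁
    obtain ⟨i, rfl⟩ := exists_eq_hface_of_isFacet (edgeFun_center_lt hm one_pos) h₀
    obtain ⟨j, rfl⟩ := exists_eq_hface_of_isFacet (edgeFun_center_lt hn one_pos) h₁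
    rw [hF₀, hF₁]
    exact hasOutsideFraction_capVert hm hφ i
  · intro F₀ F₁ h₀ h₁
    obtain ⟨i, rfl⟩ := exists_eq_hface_of_isFacet (edgeFun_center_lt hm one_pos) h₀
    obtain ⟨j, rfl⟩ := exists_eq_hface_of_isFacet (edgeFun_center_lt hn one_pos) h₁
    rw [hF₀, hF₁]
    exact hasOutsideFraction_capVert hn hψ j

end Realisation

/-- The sufficient condition for a realisation from regular polygons. -/
theorem exists_isRegularRealisation {m n : ℕ} (hm : 3 ≤ m) (hn : 3 ≤ n)
    (h : Real.cos (Real.pi / m) ^ 2 + Real.cos (Real.pi / n) ^ 2 ≤ 1) :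
    ∃ Q, IsRegularRealisation m n Q := by
  have : NeZero m := ⟨by omega⟩
  have : NeZero n := ⟨by omega⟩
  have hκ := cos_pi_div_pos hm
  have hκ' := cos_pi_div_pos hn
  have hn1 := pi_div_pos hn
  have hn2 := pi_div_le hn
  have hm1 := pi_div_pos hm
  have hm2 := pi_div_le hm
  have hpi := Real.pi_pos
  have hs : 0 < Real.sin (Real.pi / n) := Real.sin_pos_of_pos_of_lt_pi hn1 (by linarith)
  have hsq := Real.sin_sq_add_cos_sq (Real.pi / n)
  have hs1 : Real.sin (Real.pi / n) < 1 := by nlinarith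
  have hle : Real.cos (Real.pi / m) ≤ Real.sin (Real.pi / n) := by
    rw [← sq_le_sq₀ hκ.le hs.le]; linarith
  -- This is cos φ, solved from κ²/cos²φ + κ'²/cos²ψ = 1 with ψ = 0. The hypothesis gives `a ≤ 1`,
  -- and sin(π/n) < 1 gives κ < `a`, that is |φ| < π/m.
  set a := Real.cos (Real.pi / m) / Real.sin (Real.pi / n) with ha
  have ha0 : 0 < a := div_pos hκ hs
  have ha1 : a ≤ 1 := (div_le_one hs).2 hle
  have hak : Real.cos (Real.pi / m) < a := by
    rw [ha, lt_div_iff₀ hs]; nlinarith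
  have hcos : Real.cos (Real.arccos a) = a := Real.cos_arccos (by linarith) ha1
  have hφ : |Real.arccos a| < Real.pi / m := by
    rw [abs_of_nonneg (Real.arccos_nonneg a)]
    rw [← hcos] at hak
    exact (Real.strictAntiOn_cos.lt_iff_gt ⟨hm1.le, by linarith⟩
      ⟨Real.arccos_nonneg a, Real.arccos_le_pi a⟩).1 hak
  refine ⟨_, isRegularRealisation_hpoly hm hn hφ (ψ := 0) (by simpa using hn1) ?_⟩
  simp only [capHeight, capRadius, hcos, Real.cos_zero]
  rw [ha]
  field_simp
  linarith

end EConstruction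

theorem corollary4p3 (m n : ℕ) (hm : 3 ≤ m) (hn : 3 ≤ n) :
    (∃ Q : Set (EuclideanSpace ℝ (Fin 2) × EuclideanSpace ℝ (Fin 2)),
      EConstruction.IsRegularRealisation m n Q) ↔
    ((m, n) ∈ ({(3, 3), (3, 4), (3, 5), (3, 6), (4, 4)} : Set (ℕ × ℕ)) ∨
      (n, m) ∈ ({(3, 3), (3, 4), (3, 5), (3, 6), (4, 4)} : Set (ℕ × ℕ))) := by
  rw [← EConstruction.mul_le_two_mul_add_iff hm hn,
    ← EConstruction.cos_sq_add_cos_sq_le_one_iff hm hn]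
  exact ⟨fun ⟨_, hQ⟩ => EConstruction.cos_sq_add_cos_sq_le_one_of_isRegularRealisation hm hn hQ,
    EConstruction.exists_isRegularRealisation hm hn⟩
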